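/- Let $A$ be a locally compact Hausdorff abelian torsion group, written additively. For a prime $p$ let $A_p$ be the subgroup of all $x\in A$ with $p^kx\to 0$ as $k\to\infty$ (the $p$-primary component); let $\pi(A)$ be the set of primes $p$ with $A_p\neq\{0\}$; and for a set $\sigma$ of primes let $A_\sigma$ be the closed subgroup of $A$ topologically generated by the $A_p$ with $p\in\sigma$. The following statements are equivalent: (a) $A$ is topologically modular, i.e. for all closed subgroups $X,Y,Z$ of $A$ with $X\subseteq Z$ one has $\overline{X+(Y\cap Z)}=\overline{X+Y}\cap Z$. (b) There is a partition $\pi(A)=\delta\cup\phi$ into two disjoint (possibly empty) sets such that (b.1) $\phi$ is finite and $A_\phi=D_\phi\oplus V_\phi$ algebraically and topologically, where $D_\phi$ is a subgroup that is discrete, divisible and of finite $p$-rank for every $p\in\phi$, and $V_\phi$ is a subgroup that is compact and open in $A$; (b.2) $A_\delta$ is a discrete subgroup of $A$. (c) $A$ is strongly topologically quasihamiltonian, i.e. $X+Y$ is closed for all closed subgroups $X,Y$ of $A$. Here $D_\phi$ has finite $p$-rank if there is an integer $r$ such that every topologically finitely generated closed subgroup of $D_\phi\cap A_p$ can be topologically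 generated by at most $r$ elements. -/

import Mathlib

open Topology Filter

section TopologicalGroups

variable (G : Type*) [AddCommGroup G] [TopologicalSpace G] [IsTopologicalAddGroup G]

/-- The closed subgroups of `G` satisfy the modular law, where the meet of two closed subgroups is
their intersection and the join is the closure of the subgroup they generate. -/
def IsTopologicallyModular : Prop :=
  ∀ X Y Z : AddSubgroup G, IsClosed (X : Set G) → IsClosed (Y : Set G) → IsClosed (Z : Set G) →
    X ≤ Z →
      (X ⊔ (Y ⊓ Z)).topologicalClosure = (X ⊔ Y).topologicalClosure ⊓ Z

/-- The sum of any two closed subgroups is closed. -/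
def IsStronglyTopologicallyQuasihamiltonian : Prop :=
  ∀ X Y : AddSubgroup G, IsClosed (X : Set G) → IsClosed (Y : Set G) →
    IsClosed ((X ⊔ Y : AddSubgroup G) : Set G)

/-- The subgroup of `p`-elements of `G`: the elements `x` with `p ^ k • x → 0` as `k → ∞`. -/
def primaryComponent (p : ℕ) : AddSubgroup G where
  carrier := {x | Tendsto (fun k : ℕ => p ^ k • x) atTop (𝓝 0)}
  zero_mem' := by
    change Tendsto (fun k : ℕ => p ^ k • (0 : G)) atTop (𝓝 0)
    simp only [smul_zero]
    exact tendsto_const_nhds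
  add_mem' := by
    intro a b ha hb
    change Tendsto (fun k : ℕ => p ^ k • (a + b)) atTop (𝓝 0)
    have h := Tendsto.add (show Tendsto (fun k : ℕ => p ^ k • a) atTop (𝓝 0) from ha)
      (show Tendsto (fun k : ℕ => p ^ k • b) atTop (𝓝 0) from hb)
    rw [add_zero] at h
    simpa only [smul_add] using h
  neg_mem' := by
    intro a ha
    change Tendsto (fun k : ℕ => p ^ k • (-a)) atTop (𝓝 0)
    have h := Tendsto.neg (show Tendsto (fun k : ℕ => p ^ k • a) atTop (𝓝 0) from ha)
    rw [neg_zero] at h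
    simpa only [smul_neg] using h

/-- The set of primes `p` for which the `p`-primary component of `G` is nontrivial. -/
def primeSupport : Set ℕ :=
  {p | p.Prime ∧ primaryComponent G p ≠ ⊥}

/-- For a set `π` of primes, the subgroup of `G` topologically generated by the `p`-primary
components with `p ∈ π`. -/
def primaryComponentOfSet (π : Set ℕ) : AddSubgroup G :=
  (⨆ p ∈ π, primaryComponent G p).topologicalClosure

/-- For a topological abelian `p`-group: the numbers of topological generators needed by
topologically finitely generated closed subgroups are bounded. -/
def HasFinitePRank : Prop :=
  ∃ r : ℕ, ∀ F : Finset G, ∃ E : Finset G, E.card ≤ r ∧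
    (AddSubgroup.closure (E : Set G)).topologicalClosure =
      (AddSubgroup.closure (F : Set G)).topologicalClosure

variable {G}

/-- `S` is the direct sum of its subgroups `D` and `V`, algebraically and topologically. -/
def IsTopologicalDirectSum (S D V : AddSubgroup G) : Prop :=
  D ⊔ V = S ∧ IsEmbedding (fun x : D × V => (x.1 : G) + (x.2 : G))

end TopologicalGroups

/-! (c) ⇒ (a): between closed subgroups with closed sums all closures disappear, and the modular law
of the subgroup lattice remains.

(b) ⇒ (c): since `V` is open, it suffices that `(X + Y) ∩ V` is closed, and this holds once the
compact group `(X ∩ V) + (Y ∩ V)` has finite index in it. The index is controlled by `E = D ∩ (X +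
V) ∩ (Y + V)`. If `m` kills `V`, then `mE ⊆ X ∩ Y`, and `E / mE` is finite because the ranks are
finite and only finitely many primes occur.

(a) ⇒ (b): Baire's theorem makes some `A[n]` open, a compact neighbourhood of 0 yields a compact
open subgroup, and Bogolyubov's lemma yields arbitrarily small open subgroups
(`IsAddTorsion.nonarchimedeanAddGroup`). Hence there are a compact open `K` and a finite set `φ` of
primes such that `K` lies in the `φ`-part and `K[p]` is infinite for all `p ∈ φ`; the remaining
primary part meets `K` trivially and is therefore discrete.

The heart is that infinite `K[p]` forces `(A/K)[p]` to be finite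
(`IsTopologicallyModular.finite_torsion_quotient`). If `K[p]` and the image of `A[p]` in `A/K` are
both infinite, they give homomorphisms `b`, `a` from a countable direct sum of copies of `ℤ/p`, and
modularity fails for the ranges of `a + b` and `a` and a limit point of the range of `b`
(`not_isTopologicallyModular_of_homs`). If only `(A/K)[p]` is infinite, a suitable quotient of `A`
is of this kind.

Finally, with `S` the `φ`-part and `R` the product of `φ`, finiteness of the socle of `A/K` makes a
multiple `R ^ e • S` divisible and discrete, and a compact group supplies the rest of `S`. Divisible
groups being injective, `R ^ e • S` has a complement, which can be chosen compact and open. -/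

/-! ### Fourier analysis and Bogolyubov's lemma. -/

section Bogolyubov

open Finset ComplexConjugate

/-- Parseval's identity for the indicator function of `B`. -/
theorem AddChar.sum_norm_sq_sum_apply {G : Type*} [AddCommGroup G] [Fintype G] (B : Finset G) :
    ∑ χ : AddChar G ℂ, ‖∑ b ∈ B, χ b‖ ^ 2 = Fintype.card G * #B := by
  classical
  have h : ∀ χ : AddChar G ℂ, ((‖∑ b ∈ B, χ b‖ ^ 2 : ℝ) : ℂ) = ∑ a ∈ B, ∑ b ∈ B, χ (a - b) := by
    intro χ
    rw [Complex.ofReal_pow, ← Complex.mul_conj', map_sum (starRingEnd ℂ), sum_mul_sum]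
    refine sum_congr rfl fun a _ => sum_congr rfl fun b _ => ?_
    rw [sub_eq_add_neg, AddChar.map_add_eq_mul, AddChar.map_neg_eq_conj]
  have h2 : ((∑ χ : AddChar G ℂ, ‖∑ b ∈ B, χ b‖ ^ 2 : ℝ) : ℂ) = Fintype.card G * #B := by
    rw [Complex.ofReal_sum]
    simp_rw [h]
    rw [sum_comm]
    simp_rw [sum_comm (s := univ) (t := B), AddChar.sum_apply_eq_ite, sub_eq_zero]
    simp [mul_comm]
  exact_mod_cast h2

/-- By orthogonality the sum is `card G` times the number of representations `x = a + b - c - d` in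
`B`. -/
theorem AddChar.sum_norm_pow_four_mul_eq_zero {G : Type*} [AddCommGroup G] [Fintype G]
    (B : Finset G) (x : G) (hx : ∀ a ∈ B, ∀ b ∈ B, ∀ c ∈ B, ∀ d ∈ B, x ≠ a + b - c - d) :
    ∑ χ : AddChar G ℂ, ((‖∑ b ∈ B, χ b‖ ^ 4 : ℝ) : ℂ) * χ (-x) = 0 := by
  classical
  have h : ∀ χ : AddChar G ℂ, ((‖∑ b ∈ B, χ b‖ ^ 4 : ℝ) : ℂ) * χ (-x) =
      ∑ a ∈ B, ∑ c ∈ B, ∑ d ∈ B, ∑ b ∈ B, χ (a + b - c - d - x) := by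
    intro χ
    have e : ((‖∑ b ∈ B, χ b‖ ^ 4 : ℝ) : ℂ) =
        ((∑ b ∈ B, χ b) * ((∑ b ∈ B, χ b))) * ((∑ b ∈ B, conj (χ b)) * (∑ b ∈ B, conj (χ b))) := by
      rw [← map_sum (starRingEnd ℂ), show (4 : ℕ) = 2 * 2 from rfl, pow_mul, Complex.ofReal_pow,
        Complex.ofReal_pow, ← Complex.mul_conj']
      ring
    rw [e]
    simp_rw [sum_mul, mul_sum, sum_mul]
    refine sum_congr rfl fun a _ => sum_congr rfl fun c _ => sum_congr rfl fun d _ =>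
      sum_congr rfl fun b _ => ?_
    simp only [sub_eq_add_neg, AddChar.map_add_eq_mul, AddChar.map_neg_eq_conj]
    ring
  simp_rw [h]
  rw [sum_comm]
  refine sum_eq_zero fun a ha => ?_
  rw [sum_comm]
  refine sum_eq_zero fun c hc => ?_
  rw [sum_comm]
  refine sum_eq_zero fun d hd => ?_
  rw [sum_comm]
  refine sum_eq_zero fun b hb => ?_
  rw [AddChar.sum_apply_eq_ite, if_neg]
  rw [sub_eq_zero]
  exact (hx a ha b hb c hc d hd).symm

/-- Bogolyubov's lemma in a finite abelian group of bounded exponent. -/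
theorem exists_addSubgroup_subset_add_add_sub_sub {G : Type*} [AddCommGroup G] [Fintype G]
    {n N : ℕ} (hn : n ≠ 0) (hG : ∀ x : G, n • x = 0) (B : Finset G)
    (hB : Fintype.card G ≤ N * #B) :
    ∃ H : AddSubgroup G, H.index ≤ n ^ N ^ 2 ∧
      ∀ x ∈ H, ∃ a ∈ B, ∃ b ∈ B, ∃ c ∈ B, ∃ d ∈ B, x = a + b - c - d := by
  classical
  have : NeZero n := ⟨hn⟩
  set S : AddChar G ℂ → ℝ := fun χ => ‖∑ b ∈ B, χ b‖ with hS
  set g : ℝ := (Fintype.card G : ℝ) with hg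
  set β : ℝ := (#B : ℝ) with hβ
  have hgpos : 0 < g := by rw [hg]; exact_mod_cast Fintype.card_pos
  have hβpos : 0 < β := by
    rcases Nat.eq_zero_or_pos #B with h | h
    · rw [h, mul_zero] at hB
      exact absurd hB (by have := Fintype.card_pos (α := G); omega)
    · rw [hβ]; exact_mod_cast h
  have hBr : g ≤ N * β := by rw [hg, hβ]; exact_mod_cast hB
  have hpars : ∑ χ, S χ ^ 2 = g * β := AddChar.sum_norm_sq_sum_apply B
  -- The large spectrum. By Parseval it has at most `(g / β) ^ 2 ≤ N ^ 2` members, and outside it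
  -- the fourth moment is at most `β ^ 3 / g` times the second, hence too small to cancel the term
  -- `β ^ 4` of the trivial character.
  set P : Finset (AddChar G ℂ) := univ.filter fun χ => β ^ 3 ≤ S χ ^ 2 * g with hP
  have hPcard : #P ≤ N ^ 2 := by
    have h1 : (#P : ℝ) * β ^ 3 ≤ g * β * g := by
      rw [← hpars, sum_mul, ← nsmul_eq_mul, ← sum_const]
      calc ∑ _i ∈ P, β ^ 3 ≤ ∑ i ∈ P, S i ^ 2 * g :=
            sum_le_sum fun i hi => (mem_filter.1 hi).2
        _ ≤ _ := sum_le_sum_of_subset_of_nonneg (subset_univ _) fun i _ _ => by positivity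
    have h2 : (#P : ℝ) * β ^ 2 ≤ (N : ℝ) ^ 2 * β ^ 2 := by
      have : (#P : ℝ) * β ^ 2 ≤ g * g := by
        refine le_of_mul_le_mul_right ?_ hβpos
        calc (#P : ℝ) * β ^ 2 * β = #P * β ^ 3 := by ring
          _ ≤ _ := h1
          _ = _ := by ring
      calc _ ≤ g * g := this
        _ ≤ (N * β) * (N * β) := by gcongr
        _ = _ := by ring
    have h3 : (#P : ℝ) ≤ (N : ℝ) ^ 2 := le_of_mul_le_mul_right h2 (by positivity)
    exact_mod_cast h3
  have hroot : ∀ (χ : AddChar G ℂ) (x : G), χ x ^ n = 1 := fun χ x => by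
    rw [← AddChar.map_nsmul_eq_pow, hG, AddChar.map_zero_eq_one]
  let r : AddChar G ℂ → G → rootsOfUnity n ℂ := fun χ x =>
    rootsOfUnity.mkOfPowEq (χ x) (hroot χ x)
  let f : G →+ Additive (P → rootsOfUnity n ℂ) :=
    { toFun := fun x => Additive.ofMul fun χ => r χ x
      map_zero' := by
        apply Additive.toMul.injective
        funext χ
        ext
        simp [r]
      map_add' := fun x y => by
        apply Additive.toMul.injective
        funext χ
        ext
        simp [r, AddChar.map_add_eq_mul] }
  have hf : ∀ x ∈ f.ker, ∀ χ ∈ P, χ x = 1 := fun x hx χ hχ => by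
    have h1 : Additive.toMul (f x) ⟨χ, hχ⟩ = 1 := by
      rw [AddMonoidHom.mem_ker.1 hx]; rfl
    have h2 := congrArg (fun z : rootsOfUnity n ℂ => ((z : ℂˣ) : ℂ)) h1
    simpa [f, r] using h2
  refine ⟨f.ker, ?_, fun x hx => ?_⟩
  · rw [AddSubgroup.index_ker]
    have : Finite (Additive (P → rootsOfUnity n ℂ)) :=
      inferInstanceAs (Finite (P → rootsOfUnity n ℂ))
    calc Nat.card f.range ≤ Nat.card (Additive (P → rootsOfUnity n ℂ)) :=
          Nat.card_le_card_of_injective _ Subtype.val_injective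
      _ = Nat.card (P → rootsOfUnity n ℂ) := rfl
      _ = n ^ #P := by rw [Nat.card_fun, Complex.card_rootsOfUnity]; simp
      _ ≤ _ := Nat.pow_le_pow_right (Nat.pos_of_ne_zero hn) hPcard
  by_contra! hcon
  have h0 := AddChar.sum_norm_pow_four_mul_eq_zero B x hcon
  rw [← sum_filter_add_sum_filter_not univ (fun χ => β ^ 3 ≤ S χ ^ 2 * g)] at h0
  have h1 : ∑ χ ∈ P, ((S χ ^ 4 : ℝ) : ℂ) * χ (-x) = ((∑ χ ∈ P, S χ ^ 4 : ℝ) : ℂ) := by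
    rw [Complex.ofReal_sum]
    refine sum_congr rfl fun χ hχ => ?_
    rw [hf (-x) (neg_mem hx) χ hχ, mul_one]
  have h2 : ∑ χ ∈ P, S χ ^ 4 ≤ ∑ χ ∈ univ.filter (fun χ => ¬ β ^ 3 ≤ S χ ^ 2 * g), S χ ^ 4 := by
    have e := eq_neg_of_add_eq_zero_left h0
    rw [h1] at e
    have e2 := congrArg norm e
    rw [norm_neg, Complex.norm_real, Real.norm_of_nonneg (sum_nonneg fun _ _ => by positivity)] at e2
    rw [e2]
    refine (norm_sum_le _ _).trans (sum_le_sum fun χ _ => ?_)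
    rw [norm_mul, AddChar.norm_apply, mul_one, Complex.norm_real,
      Real.norm_of_nonneg (by positivity)]
  have hone : S 0 = β := by simp [hS, hβ]
  have hBg : β ≤ g := by rw [hg, hβ]; exact_mod_cast card_le_univ B
  have hmem : (0 : AddChar G ℂ) ∈ P := by
    rw [hP, mem_filter, hone]
    refine ⟨mem_univ _, ?_⟩
    calc β ^ 3 = β ^ 2 * β := by ring
      _ ≤ _ := by gcongr
  have h3 : β ^ 4 ≤ ∑ χ ∈ P, S χ ^ 4 := by
    rw [← hone]
    exact single_le_sum (f := fun χ => S χ ^ 4) (fun _ _ => by positivity) hmem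
  have h4 : (∑ χ ∈ univ.filter (fun χ => ¬ β ^ 3 ≤ S χ ^ 2 * g), S χ ^ 4) * g ≤
      β ^ 3 * (g * β - β ^ 2) := by
    -- Leaving out the trivial character, which lies in `P`, saves `β ^ 2`; this makes the final
    -- inequality strict.
    have h5 : β ^ 2 + ∑ χ ∈ univ.filter (fun χ => ¬ β ^ 3 ≤ S χ ^ 2 * g), S χ ^ 2 ≤ g * β := by
      rw [← hpars, ← sum_filter_add_sum_filter_not univ (fun χ => β ^ 3 ≤ S χ ^ 2 * g)]
      gcongr
      have := single_le_sum (f := fun χ => S χ ^ 2) (fun _ _ => by positivity) hmem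
      rwa [hone] at this
    calc _ ≤ ∑ χ ∈ univ.filter (fun χ => ¬ β ^ 3 ≤ S χ ^ 2 * g), β ^ 3 * S χ ^ 2 := by
          rw [sum_mul]
          refine sum_le_sum fun χ hχ => ?_
          have := (not_le.1 (mem_filter.1 hχ).2).le
          calc S χ ^ 4 * g = (S χ ^ 2 * g) * S χ ^ 2 := by ring
            _ ≤ _ := by gcongr
      _ = β ^ 3 * ∑ χ ∈ univ.filter (fun χ => ¬ β ^ 3 ≤ S χ ^ 2 * g), S χ ^ 2 := by
          rw [mul_sum]
      _ ≤ _ := by gcongr; linarith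
  have h6 : β ^ 4 * g ≤ β ^ 3 * (g * β - β ^ 2) :=
    le_trans (by gcongr; exact h3.trans h2) h4
  have : 0 < β ^ 5 := by positivity
  nlinarith

/-- Bogolyubov's lemma in an abelian group of bounded exponent: if finitely many translates of `B`
cover the group, then `B + B - B - B` contains a subgroup of finite index. -/
theorem exists_finiteIndex_subset_add_add_sub_sub {G : Type*} [AddCommGroup G]
    {n : ℕ} (hn : n ≠ 0) (hG : ∀ x : G, n • x = 0) (B : Set G) (T : Finset G)
    (hB : ∀ x : G, ∃ t ∈ T, x - t ∈ B) :
    ∃ H : AddSubgroup G, H.FiniteIndex ∧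
      ∀ x ∈ H, ∃ a ∈ B, ∃ b ∈ B, ∃ c ∈ B, ∃ d ∈ B, x = a + b - c - d := by
  classical
  have htors : IsAddTorsion G := fun x => isOfFinAddOrder_iff_nsmul_eq_zero.2
    ⟨n, Nat.pos_of_ne_zero hn, hG x⟩
  set M := n ^ #T ^ 2 with hM
  have key : ∀ S : Finset G, ∃ H : AddSubgroup G,
      (T ⊆ S → ∀ x ∈ H, ∃ a ∈ B, ∃ b ∈ B, ∃ c ∈ B, ∃ d ∈ B, x = a + b - c - d) ∧
      (T ⊆ S → ∀ y : Fin (M + 1) → G, (∀ i, y i ∈ S) → ∃ q : Fin (M + 1) × Fin (M + 1),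
        q.1 ≠ q.2 ∧ y q.1 - y q.2 ∈ H) := by
    intro S
    by_cases hTS : T ⊆ S
    swap
    · exact ⟨⊥, fun h => absurd h hTS, fun h => absurd h hTS⟩
    set F := AddSubgroup.closure (S : Set G) with hF
    have hfg : AddGroup.FG F := (AddGroup.fg_iff_addSubgroup_fg F).2 ⟨S, rfl⟩
    have : Finite F := AddCommGroup.finite_of_fg_isAddTorsion F (htors.addSubgroup F)
    have := Fintype.ofFinite F
    set B' : Finset F := univ.filter fun x => (x : G) ∈ B with hB'
    have hT : ∀ t ∈ T, t ∈ F := fun t ht => AddSubgroup.subset_closure (hTS ht)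
    have hcard : Fintype.card F ≤ #T * #B' := by
      rw [← card_univ]
      have hsub : (univ : Finset F) ⊆ (T.attach ×ˢ B').image
          fun q => (⟨q.1.1, hT _ q.1.2⟩ : F) + q.2 := by
        intro x _
        obtain ⟨t, ht, hxt⟩ := hB x
        refine mem_image.2 ⟨(⟨t, ht⟩, x - ⟨t, hT t ht⟩), mem_product.2 ⟨mem_attach _ _, ?_⟩, ?_⟩
        · exact mem_filter.2 ⟨mem_univ _, hxt⟩
        · simp
      refine (card_le_card hsub).trans (card_image_le.trans ?_)
      rw [card_product, card_attach]
    obtain ⟨H, hH1, hH2⟩ := exists_addSubgroup_subset_add_add_sub_sub hn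
      (fun x : F => Subtype.ext (by simpa using hG x)) B' hcard
    refine ⟨H.map F.subtype, fun _ x hx => ?_, fun _ y hy => ?_⟩
    · obtain ⟨x', hx', rfl⟩ := hx
      obtain ⟨a, ha, b, hb, c, hc, d, hd, rfl⟩ := hH2 x' hx'
      exact ⟨a, (mem_filter.1 ha).2, b, (mem_filter.1 hb).2, c, (mem_filter.1 hc).2, d,
        (mem_filter.1 hd).2, by simp⟩
    · let z : Fin (M + 1) → F ⧸ H := fun i =>
        ((⟨y i, AddSubgroup.subset_closure (hy i)⟩ : F) : F ⧸ H)
      have : ¬ Function.Injective z := fun hz => by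
        have := Nat.card_le_card_of_injective z hz
        rw [Nat.card_eq_fintype_card, Fintype.card_fin] at this
        have h2 : Nat.card (F ⧸ H) ≤ M := hH1
        omega
      simp only [Function.Injective, not_forall] at this
      obtain ⟨i, j, hij, hne⟩ := this
      refine ⟨(j, i), fun h => hne h.symm, ?_⟩
      refine ⟨-⟨y i, AddSubgroup.subset_closure (hy i)⟩ +
        ⟨y j, AddSubgroup.subset_closure (hy j)⟩, QuotientAddGroup.eq.1 hij, ?_⟩
      simp [neg_add_eq_sub]
  choose H hH1 hH2 using key
  let 𝒰 : Ultrafilter (Finset G) := Ultrafilter.of atTop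
  have h𝒰 : (𝒰 : Filter (Finset G)) ≤ atTop := Ultrafilter.of_le _
  have hTe : ∀ᶠ S in (𝒰 : Filter (Finset G)), T ⊆ S := h𝒰 (eventually_ge_atTop T)
  -- Limit of the groups `H S` along the ultrafilter. Among any `M + 1` elements two are congruent
  -- modulo `H S`, for almost all `S`; as there are finitely many pairs, one pair works for almost
  -- all `S`. So `L` has finite index.
  let L : AddSubgroup G :=
    { carrier := {x | ∀ᶠ S in (𝒰 : Filter (Finset G)), x ∈ H S}
      zero_mem' := Eventually.of_forall fun S => zero_mem _
      add_mem' := fun ha hb => by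
        filter_upwards [ha, hb] with S h1 h2 using add_mem h1 h2
      neg_mem' := fun ha => by
        filter_upwards [ha] with S h1 using neg_mem h1 }
  refine ⟨L, ?_, fun x hx => ?_⟩
  · have hfin : Finite (G ⧸ L) := by
      by_contra hinf
      rw [not_finite_iff_infinite] at hinf
      obtain ⟨e⟩ : Nonempty (Fin (M + 1) ↪ G ⧸ L) := ⟨(Fin.valEmbedding).trans
        (Infinite.natEmbedding (G ⧸ L))⟩
      have hev : ∀ᶠ S in (𝒰 : Filter (Finset G)), ∃ q : Fin (M + 1) × Fin (M + 1),
          q.1 ≠ q.2 ∧ (e q.1).out - (e q.2).out ∈ H S := by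
        filter_upwards [hTe, h𝒰 (eventually_ge_atTop (univ.image fun i => (e i).out))] with S h1 h2
        exact hH2 S h1 _ fun i => h2 (mem_image_of_mem _ (mem_univ i))
      rw [Ultrafilter.eventually_exists_iff] at hev
      obtain ⟨q, hq⟩ := hev
      obtain ⟨_, hq1, _⟩ := hq.exists
      apply hq1
      apply e.injective
      rw [← QuotientAddGroup.out_eq' (e q.1), ← QuotientAddGroup.out_eq' (e q.2)]
      refine (QuotientAddGroup.eq.2 ?_).symm
      rw [neg_add_eq_sub]
      filter_upwards [hq] with S h using h.2
    exact AddSubgroup.finiteIndex_of_finite_quotient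
  · obtain ⟨S, h1, h2⟩ := (hTe.and hx).exists
    exact hH1 S h1 x h2

end Bogolyubov

/-! ### Open and compact subgroups of locally compact torsion groups. -/

section CompactOpen

open Pointwise

variable {A : Type*} [AddCommGroup A] [TopologicalSpace A] [IsTopologicalAddGroup A]

/-- Closedness is local at 0: a limit point of `X` differs from an element of `X` by an element of
`W`, and that element is a limit point of `X ⊓ W`. -/
theorem AddSubgroup.isClosed_of_isClosed_inf {X W : AddSubgroup A} (hW : IsOpen (W : Set A))
    (h : IsClosed ((X ⊓ W : AddSubgroup A) : Set A)) : IsClosed (X : Set A) := by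
  rw [← closure_subset_iff_isClosed]
  intro x hx
  have hnhds : (fun y => y - x) ⁻¹' (W : Set A) ∈ 𝓝 x :=
    (continuous_id.sub continuous_const).continuousAt.preimage_mem_nhds
      (by simpa using hW.mem_nhds (zero_mem W))
  obtain ⟨y, hyW, hyX⟩ := mem_closure_iff_nhds.1 hx _ hnhds
  have h1 : y - x ∈ _root_.closure (X : Set A) := by
    exact sub_mem (X.le_topologicalClosure hyX) (show x ∈ X.topologicalClosure from hx)
  have h2 : y - x ∈ _root_.closure ((X : Set A) ∩ W) := by
    rw [Set.inter_comm]
    exact hW.inter_closure ⟨hyW, h1⟩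
  have h3 : y - x ∈ X ⊓ W := h.closure_subset (by simpa using h2)
  have := sub_mem hyX h3.1
  rwa [SetLike.mem_coe, show x = y - (y - x) by abel]

theorem AddSubgroup.isClosed_of_finite_cosets {J L : AddSubgroup A} (hJ : IsClosed (J : Set A))
    (hJL : J ≤ L) {F : Set A} (hF : F.Finite) (hL : ∀ x ∈ L, ∃ f ∈ F, x - f ∈ J) :
    IsClosed (L : Set A) := by
  have : (L : Set A) = ⋃ f ∈ F ∩ L, (fun x => x - f) ⁻¹' (J : Set A) := by
    ext x
    simp only [SetLike.mem_coe, Set.mem_iUnion, Set.mem_preimage, exists_prop, Set.mem_inter_iff]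
    constructor
    · intro hx
      obtain ⟨f, hf, hxf⟩ := hL x hx
      refine ⟨f, ⟨hf, ?_⟩, hxf⟩
      have := sub_mem hx (hJL hxf)
      rwa [sub_sub_cancel] at this
    · rintro ⟨f, ⟨_, hf⟩, hxf⟩
      have := add_mem (hJL hxf) hf
      rwa [sub_add_cancel] at this
  rw [this]
  exact (hF.inter_of_left _).isClosed_biUnion fun f _ =>
    hJ.preimage (continuous_id.sub continuous_const)

theorem AddSubgroup.isCompact_of_finite_cosets {J L : AddSubgroup A} (hJ : IsCompact (J : Set A))
    (hJL : J ≤ L) {F : Set A} (hF : F.Finite) (hL : ∀ x ∈ L, ∃ f ∈ F, x - f ∈ J) :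
    IsCompact (L : Set A) := by
  have : (L : Set A) = ⋃ f ∈ F ∩ L, (fun x => x + f) '' (J : Set A) := by
    ext x
    simp only [SetLike.mem_coe, Set.mem_iUnion, Set.mem_image, exists_prop, Set.mem_inter_iff]
    constructor
    · intro hx
      obtain ⟨f, hf, hxf⟩ := hL x hx
      refine ⟨f, ⟨hf, ?_⟩, x - f, hxf, sub_add_cancel _ _⟩
      have := sub_mem hx (hJL hxf)
      rwa [sub_sub_cancel] at this
    · rintro ⟨f, ⟨_, hf⟩, y, hy, rfl⟩
      exact add_mem (hJL hy) hf
  rw [this]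
  exact (hF.inter_of_left _).isCompact_biUnion fun f _ =>
    hJ.image (continuous_id.add continuous_const)

/-- Finitely many cosets of an open subgroup cover a compact set. -/
theorem IsCompact.exists_finite_cosets {K : Set A} (hK : IsCompact K) {W : AddSubgroup A}
    (hW : IsOpen (W : Set A)) : ∃ F ⊆ K, F.Finite ∧ ∀ x ∈ K, ∃ f ∈ F, x - f ∈ W := by
  obtain ⟨t, htK, htf, ht⟩ := hK.elim_finite_subcover_image (b := K)
    (c := fun f => (fun x => x - f) ⁻¹' (W : Set A))
    (fun f _ => hW.preimage (continuous_id.sub continuous_const))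
    (fun x hx => Set.mem_biUnion hx (by simp))
  refine ⟨t, htK, htf, fun x hx => ?_⟩
  simpa using ht hx

theorem IsAddTorsion.finite_closure {A : Type*} [AddCommGroup A] (hA : IsAddTorsion A) {F : Set A}
    (hF : F.Finite) : (AddSubgroup.closure F : Set A).Finite := by
  have hfg : AddGroup.FG (AddSubgroup.closure F) :=
    (AddGroup.fg_iff_addSubgroup_fg _).2 ⟨hF.toFinset, by simp⟩
  exact AddCommGroup.finite_of_fg_isAddTorsion (AddSubgroup.closure F) (hA.addSubgroup _)

/-- Baire's theorem for the closed subgroups killed by `k!`. Factorials keep the multiplier nonzero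
also for `k = 0`. -/
theorem IsAddTorsion.exists_isOpen_ker_nsmul [LocallyCompactSpace A] [T2Space A]
    (hA : IsAddTorsion A) :
    ∃ n : ℕ, n ≠ 0 ∧ IsOpen ((nsmulAddMonoidHom n : A →+ A).ker : Set A) := by
  have hcl : ∀ k : ℕ, IsClosed ((nsmulAddMonoidHom k : A →+ A).ker : Set A) := fun k =>
    isClosed_singleton.preimage (continuous_nsmul k)
  obtain ⟨k, hk⟩ := nonempty_interior_of_iUnion_of_closed
    (f := fun k : ℕ => ((nsmulAddMonoidHom k.factorial : A →+ A).ker : Set A))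
    (fun k => hcl _) (Set.eq_univ_of_forall fun x => by
      obtain ⟨m, hm, hmx⟩ := isOfFinAddOrder_iff_nsmul_eq_zero.1 (hA x)
      refine Set.mem_iUnion.2 ⟨m, ?_⟩
      obtain ⟨c, hc⟩ := Nat.dvd_factorial hm le_rfl
      change m.factorial • x = 0
      rw [hc, mul_comm, mul_smul, hmx, smul_zero])
  refine ⟨k.factorial, Nat.factorial_ne_zero k, ?_⟩
  obtain ⟨x, hx⟩ := hk
  exact AddSubgroup.isOpen_of_mem_nhds _ (mem_interior_iff_mem_nhds.1 hx)

theorem IsAddTorsion.exists_isCompact_isOpen [LocallyCompactSpace A] (hA : IsAddTorsion A) :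
    ∃ K : AddSubgroup A, IsCompact (K : Set A) ∧ IsOpen (K : Set A) := by
  obtain ⟨U₀, hU₀c, hU₀⟩ := exists_compact_mem_nhds (0 : A)
  set U : Set A := U₀ ∪ -U₀ with hU
  have hUc : IsCompact U := hU₀c.union hU₀c.neg
  have hUn : U ∈ 𝓝 (0 : A) := mem_of_superset hU₀ Set.subset_union_left
  have hUneg : ∀ x ∈ U, -x ∈ U := by
    rintro x (h | h)
    · exact Or.inr (by simpa using h)
    · exact Or.inl h
  have h0 : (0 : A) ∈ U := mem_of_mem_nhds hUn
  obtain ⟨F, -, hFf, hF⟩ := (hUc.add hUc).elim_finite_subcover_image (b := Set.univ)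
    (c := fun f : A => (fun x => x - f) ⁻¹' interior U)
    (fun f _ => isOpen_interior.preimage (continuous_id.sub continuous_const))
    (fun x _ => Set.mem_biUnion (Set.mem_univ x)
      (by simpa using mem_interior_iff_mem_nhds.2 hUn))
  let H := AddSubgroup.closure F
  have hH : (H : Set A).Finite := hA.finite_closure hFf
  -- Since `U + U ⊆ U + F`, the set `U + H` is closed under addition; it is compact because the
  -- finitely generated torsion group `H` is finite.
  let K : AddSubgroup A :=
    { carrier := U + (H : Set A)
      zero_mem' := ⟨0, h0, 0, zero_mem H, by simp⟩
      add_mem' := by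
        rintro _ _ ⟨u, hu, h, hh, rfl⟩ ⟨u', hu', h', hh', rfl⟩
        obtain ⟨f, hf, hx⟩ := Set.mem_iUnion₂.1 (hF (Set.add_mem_add hu hu'))
        exact ⟨u + u' - f, interior_subset hx, f + (h + h'),
          add_mem (AddSubgroup.subset_closure hf) (add_mem hh hh'), by dsimp only; abel⟩
      neg_mem' := by
        rintro _ ⟨u, hu, h, hh, rfl⟩
        exact ⟨-u, hUneg u hu, -h, neg_mem hh, by dsimp only; abel⟩ }
  refine ⟨K, hUc.add hH.isCompact, AddSubgroup.isOpen_of_mem_nhds K (g := 0)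
    (mem_of_superset hUn fun u hu => ⟨u, hu, 0, zero_mem H, by simp⟩)⟩

theorem IsAddTorsion.exists_isCompact_isOpen_nsmul_eq_zero [LocallyCompactSpace A] [T2Space A]
    (hA : IsAddTorsion A) : ∃ K : AddSubgroup A, IsCompact (K : Set A) ∧ IsOpen (K : Set A) ∧
      ∃ n : ℕ, n ≠ 0 ∧ ∀ x ∈ K, n • x = 0 := by
  obtain ⟨K, hKc, hKo⟩ := hA.exists_isCompact_isOpen
  obtain ⟨n, hn, hno⟩ := hA.exists_isOpen_ker_nsmul
  exact ⟨K ⊓ (nsmulAddMonoidHom n : A →+ A).ker,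
    hKc.inter_right (AddSubgroup.isClosed_of_isOpen _ hno), hKo.inter hno, n, hn,
    fun x hx => hx.2⟩

/-- A locally compact Hausdorff abelian torsion group has arbitrarily small open subgroups. -/
theorem IsAddTorsion.nonarchimedeanAddGroup [LocallyCompactSpace A] [T2Space A]
    (hA : IsAddTorsion A) : NonarchimedeanAddGroup A where
  is_nonarchimedean := by
    intro U hU
    obtain ⟨K, hKc, hKo, n, hn, hnK⟩ := hA.exists_isCompact_isOpen_nsmul_eq_zero
    -- The sums `a + b - c - d` from `W` stay in `V`; a second summand from `V` absorbs the passage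
    -- to the closure of `H`, which is open, being closed of finite index.
    obtain ⟨V, hVo, hV0, hV⟩ := exists_open_nhds_zero_half hU
    obtain ⟨V₂, hV₂o, hV₂0, hV₂⟩ := exists_open_nhds_zero_half (hVo.mem_nhds hV0)
    obtain ⟨V₄, hV₄o, hV₄0, hV₄⟩ := exists_open_nhds_zero_half (hV₂o.mem_nhds hV₂0)
    set W : Set A := V₄ ∩ -V₄ with hW
    have hWo : IsOpen W := hV₄o.inter hV₄o.neg
    have hW0 : (0 : A) ∈ W := ⟨hV₄0, by simpa using hV₄0⟩
    have hWneg : ∀ x ∈ W, -x ∈ W := fun x hx => ⟨hx.2, by simpa using hx.1⟩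
    obtain ⟨T, hTK, hTf, hT⟩ := hKc.elim_finite_subcover_image (b := (K : Set A))
      (c := fun f : A => (fun x => x - f) ⁻¹' W)
      (fun f _ => hWo.preimage (continuous_id.sub continuous_const))
      (fun x hx => Set.mem_biUnion hx (by simpa using hW0))
    have hTf' : ((Subtype.val : K → A) ⁻¹' T).Finite := hTf.preimage Subtype.val_injective.injOn
    obtain ⟨H, hHfin, hH⟩ := exists_finiteIndex_subset_add_add_sub_sub (G := K) hn
      (fun x => Subtype.ext (by simpa using hnK x x.2)) (Subtype.val ⁻¹' W) hTf'.toFinset (by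
        intro x
        obtain ⟨t, ht, hx⟩ := Set.mem_iUnion₂.1 (hT x.2)
        exact ⟨⟨t, hTK ht⟩, by simpa using ht, by simpa using hx⟩)
    have hfin : H.topologicalClosure.FiniteIndex :=
      AddSubgroup.finiteIndex_of_le H.le_topologicalClosure
    have hopen := AddSubgroup.isOpen_of_isClosed_of_finiteIndex H.topologicalClosure
      H.isClosed_topologicalClosure
    refine ⟨⟨H.topologicalClosure.map K.subtype, ?_⟩, ?_⟩
    · exact hKo.isOpenMap_subtype_val _ hopen
    · rintro _ ⟨x, hx, rfl⟩
      have hnhds : (fun y : K => ((x - y : K) : A)) ⁻¹' V ∈ 𝓝 x :=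
        ContinuousAt.preimage_mem_nhds (by fun_prop) (by simpa using hVo.mem_nhds hV0)
      obtain ⟨y, hyV, hyH⟩ := mem_closure_iff_nhds.1 hx _ hnhds
      obtain ⟨a, ha, b, hb, c, hc, d, hd, rfl⟩ := hH y hyH
      have h1 := hV₂ _ (hV₄ _ ha.1 _ hb.1) _ (hV₄ _ hc.2 _ hd.2)
      have h2 := hV _ h1 _ hyV
      simp only [AddSubgroup.coe_sub, AddSubgroup.coe_add] at h2
      rwa [AddSubgroup.coe_subtype, show (x : A) = (a : A) + b + (-c + -d) + (x - (a + b - c - d)) by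
        abel]

end CompactOpen

/-! ### The obstruction to modularity. -/

section NotModular

/-- Over a finite field an infinite space is infinite-dimensional; lift countably many basis
vectors. -/
theorem exists_finsupp_linearMap_injective {k V W : Type*} [Field k] [Finite k] [AddCommGroup V]
    [AddCommGroup W] [Module k V] [Module k W] [Infinite W] (f : V →ₗ[k] W)
    (hf : Function.Surjective f) : ∃ a : (ℕ →₀ k) →ₗ[k] V, Function.Injective (f ∘ₗ a) := by
  have hbas : Infinite (Module.Basis.ofVectorSpaceIndex k W) := by
    by_contra h
    rw [not_infinite_iff_finite] at h
    have : Module.Finite k W := Module.Finite.of_basis (Module.Basis.ofVectorSpace k W)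
    exact not_finite_iff_infinite.2 ‹Infinite W› (Module.finite_of_finite k)
  let e := Infinite.natEmbedding (Module.Basis.ofVectorSpaceIndex k W)
  have hli : LinearIndependent k (fun i => Module.Basis.ofVectorSpace k W (e i)) :=
    (Module.Basis.ofVectorSpace k W).linearIndependent.comp e e.injective
  choose l hl using fun i : ℕ => hf (Module.Basis.ofVectorSpace k W (e i))
  refine ⟨Finsupp.linearCombination k l, ?_⟩
  have : f ∘ₗ Finsupp.linearCombination k l =
      Finsupp.linearCombination k (fun i => Module.Basis.ofVectorSpace k W (e i)) := by
    ext i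
    simp [hl]
  rw [this]
  exact hli

theorem exists_finsupp_addMonoidHom_injective {V W : Type*} [AddCommGroup V] [AddCommGroup W]
    {p : ℕ} [Fact p.Prime] (hV : ∀ x : V, p • x = 0) (f : V →+ W) (hf : (Set.range f).Infinite) :
    ∃ a : (ℕ →₀ ZMod p) →+ V, Function.Injective (f.comp a) := by
  have hR : ∀ x : f.range, p • x = 0 := by
    rintro ⟨_, x, rfl⟩
    ext
    simp [← map_nsmul, hV]
  let _ : Module (ZMod p) V := AddCommGroup.zmodModule hV
  let _ : Module (ZMod p) f.range := AddCommGroup.zmodModule hR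
  have hinf : Infinite f.range := hf.to_subtype
  obtain ⟨a, ha⟩ := exists_finsupp_linearMap_injective (f.rangeRestrict.toZModLinearMap p)
    f.rangeRestrict_surjective
  exact ⟨a.toAddMonoidHom, fun x y hxy => ha (Subtype.ext hxy)⟩

theorem zsmul_eq_zero_of_zsmul_mem {B : Type*} [AddCommGroup B] {R : AddSubgroup B}
    {p : ℕ} (hp : p.Prime) {v : B} (hv : p • v = 0)
    (hvR : v ∉ R) {c : ℤ} (hc : c • v ∈ R) : c • v = 0 := by
  by_cases h : (p : ℤ) ∣ c
  · obtain ⟨d, rfl⟩ := h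
    rw [mul_comm, mul_smul, natCast_zsmul, hv, smul_zero]
  · have hcop : IsCoprime c p := ((Nat.prime_iff_prime_int.1 hp).coprime_iff_not_dvd.2 h).symm
    obtain ⟨u, w, huw⟩ := hcop
    exfalso
    apply hvR
    have : v = u • c • v + w • (p : ℤ) • v := by
      rw [← mul_smul, ← mul_smul, ← add_smul, huw, one_smul]
    rw [this, natCast_zsmul, hv, smul_zero, add_zero]
    exact R.zsmul_mem hc u

variable {B : Type*} [AddCommGroup B] [TopologicalSpace B] [IsTopologicalAddGroup B] [T2Space B]

/-- A countably infinite subgroup of a compact group is not closed. -/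
theorem not_isClosed_of_countable_of_infinite {R K : AddSubgroup B} (hK : IsCompact (K : Set B))
    (hRK : R ≤ K) [Countable R] [Infinite R] : ¬ IsClosed (R : Set B) := by
  intro hR
  have hc : CompactSpace R := isCompact_iff_compactSpace.1 (hK.of_isClosed_subset hR hRK)
  obtain ⟨x, hx⟩ := nonempty_interior_of_iUnion_of_closed (f := fun x : R => ({x} : Set R))
    (fun x => isClosed_singleton) (by ext; simp)
  have hxo : IsOpen ({x} : Set R) := by
    rw [← (Set.subset_singleton_iff_eq.1 interior_subset).resolve_left hx.ne_empty]
    exact isOpen_interior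
  have : DiscreteTopology R := by
    refine discreteTopology_of_isOpen_singleton_zero ?_
    have := hxo.preimage (continuous_add_const x)
    convert this using 1
    ext y
    simp
  exact not_finite_iff_infinite.2 ‹Infinite R› (finite_of_compact_of_discrete)

/-- By Baire the countable range of `b` is not closed; let `v` be a limit point outside it. Take `X`
the range of `a + b`, `Y` the range of `a`, and `Z = X + ⟨v⟩`. Each meets `K` in a finite group, so
all are closed. Then `Y ∩ Z = 0`, which makes the left side of the modular law `X`. But `X + Y`
contains the range of `b`, so the right side contains `v`, which is not in `X`. -/
theorem not_isTopologicallyModular_of_homs {K : AddSubgroup B} (hKc : IsCompact (K : Set B))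
    (hKo : IsOpen (K : Set B)) {p : ℕ} (hp : p.Prime) {G : Type*} [AddCommGroup G] [Countable G]
    [Infinite G] (hG : ∀ x : G, p • x = 0) (a b : G →+ B) (ha : ∀ x, a x ∈ K → x = 0)
    (hb : Function.Injective b) (hbK : ∀ x, b x ∈ K) : ¬ IsTopologicallyModular B := by
  intro hmod
  have hcl : ¬ IsClosed (b.range : Set B) := by
    have : Infinite b.range := Infinite.of_injective b.rangeRestrict fun x y h =>
      hb (congrArg Subtype.val h)
    have : Countable b.range := b.rangeRestrict_surjective.countable
    refine not_isClosed_of_countable_of_infinite hKc ?_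
    rintro _ ⟨x, rfl⟩
    exact hbK x
  obtain ⟨v, hv, hvR⟩ : ∃ v ∈ b.range.topologicalClosure, v ∉ b.range := by
    by_contra! h
    exact hcl (closure_subset_iff_isClosed.1 h)
  have hpv : p • v = 0 := by
    have : b.range.topologicalClosure ≤ (nsmulAddMonoidHom p : B →+ B).ker := by
      refine AddSubgroup.topologicalClosure_minimal _ ?_
        (isClosed_singleton.preimage (continuous_nsmul p))
      rintro _ ⟨x, rfl⟩
      change p • b x = 0
      rw [← map_nsmul, hG, map_zero]
    exact this hv
  have hvK : v ∈ K := by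
    refine AddSubgroup.topologicalClosure_minimal _ ?_ hKc.isClosed hv
    rintro _ ⟨x, rfl⟩
    exact hbK x
  set X := (a + b).range with hX
  set Y := a.range with hY
  set Z := X ⊔ AddSubgroup.zmultiples v with hZ
  have hXc : IsClosed (X : Set B) := by
    refine AddSubgroup.isClosed_of_isClosed_inf hKo ?_
    have : X ⊓ K = ⊥ := by
      rw [eq_bot_iff]
      rintro _ ⟨⟨x, rfl⟩, hx⟩
      have : x = 0 := ha x (by
        simpa using sub_mem (show (a + b) x ∈ K from hx) (hbK x))
      simp [this]
    simp [this]
  have hYc : IsClosed (Y : Set B) := by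
    refine AddSubgroup.isClosed_of_isClosed_inf hKo ?_
    have : Y ⊓ K = ⊥ := by
      rw [eq_bot_iff]
      rintro _ ⟨⟨x, rfl⟩, hx⟩
      simp [ha x hx]
    simp [this]
  have hZmem : ∀ z ∈ Z, ∃ (x : G) (c : ℤ), z = a x + b x + c • v := by
    intro z hz
    obtain ⟨_, ⟨x, rfl⟩, _, ⟨c, rfl⟩, rfl⟩ := AddSubgroup.mem_sup.1 hz
    exact ⟨x, c, rfl⟩
  have hZc : IsClosed (Z : Set B) := by
    refine AddSubgroup.isClosed_of_isClosed_inf hKo (Set.Finite.isClosed ?_)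
    have hfin : (AddSubgroup.zmultiples v : Set B).Finite :=
      finite_zmultiples.2 (isOfFinAddOrder_iff_nsmul_eq_zero.2 ⟨p, hp.pos, hpv⟩)
    refine hfin.subset ?_
    rintro z ⟨hz, hzK⟩
    obtain ⟨x, c, rfl⟩ := hZmem z hz
    have : x = 0 := ha x (by
      have := sub_mem (show _ ∈ K from hzK) (add_mem (hbK x) (K.zsmul_mem hvK c))
      rwa [add_assoc, add_sub_cancel_right] at this)
    simp [this, AddSubgroup.mem_zmultiples_iff]
  have hYZ : Y ⊓ Z = ⊥ := by
    rw [eq_bot_iff]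
    rintro _ ⟨⟨x', rfl⟩, hz⟩
    obtain ⟨x, c, hx⟩ := hZmem _ hz
    have h1 : x' - x = 0 := ha _ (by
      rw [map_sub, hx, show a x + b x + c • v - a x = b x + c • v by abel]
      exact add_mem (hbK x) (K.zsmul_mem hvK c))
    have h2 : x' = x := sub_eq_zero.1 h1
    rw [h2, add_assoc, left_eq_add] at hx
    have h3 : c • v = 0 := zsmul_eq_zero_of_zsmul_mem hp hpv hvR (R := b.range)
      ⟨-x, by rw [map_neg]; exact neg_eq_of_add_eq_zero_right hx⟩
    rw [h3, add_zero] at hx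
    have : x = 0 := hb (by rw [hx, map_zero])
    simp [h2, this]
  have hm := hmod X Y Z hXc hYc hZc le_sup_left
  rw [hYZ, sup_bot_eq] at hm
  have hvmem : v ∈ (X ⊔ Y).topologicalClosure ⊓ Z := by
    refine ⟨AddSubgroup.topologicalClosure_mono ?_ hv,
      (le_sup_right : _ ≤ Z) (AddSubgroup.mem_zmultiples v)⟩
    rintro _ ⟨x, rfl⟩
    have h1 : (a + b) x - a x ∈ X ⊔ Y :=
      sub_mem ((le_sup_left : X ≤ _) ⟨x, rfl⟩) ((le_sup_right : Y ≤ _) ⟨x, rfl⟩)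
    simpa using h1
  rw [← hm] at hvmem
  have hvX : v ∈ X := AddSubgroup.topologicalClosure_minimal X le_rfl hXc hvmem
  obtain ⟨x, hx⟩ := hvX
  have hx0 : x = 0 := ha x (by
    have := sub_mem hvK (hbK x)
    rwa [← hx, AddMonoidHom.add_apply, add_sub_cancel_right] at this)
  apply hvR
  rw [← hx, hx0, map_zero]
  exact zero_mem _

theorem not_isTopologicallyModular_of_infinite {K : AddSubgroup B} (hKc : IsCompact (K : Set B))
    (hKo : IsOpen (K : Set B)) {p : ℕ} (hp : p.Prime) (hK : {x | x ∈ K ∧ p • x = 0}.Infinite)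
    (hB : ((fun x : B => (x : B ⧸ K)) '' {x | p • x = 0}).Infinite) :
    ¬ IsTopologicallyModular B := by
  have : Fact p.Prime := ⟨hp⟩
  set T := (nsmulAddMonoidHom p : B →+ B).ker with hT
  obtain ⟨a, ha⟩ := exists_finsupp_addMonoidHom_injective (p := p)
    (fun x : T => Subtype.ext x.2) ((QuotientAddGroup.mk' K).comp T.subtype) (by
      convert hB using 1
      ext y
      constructor
      · rintro ⟨x, rfl⟩
        exact ⟨x, x.2, rfl⟩
      · rintro ⟨x, hx, rfl⟩
        exact ⟨⟨x, hx⟩, rfl⟩)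
  obtain ⟨b, hb⟩ := exists_finsupp_addMonoidHom_injective (p := p)
    (fun x : (T ⊓ K : AddSubgroup B) => Subtype.ext x.2.1) (T ⊓ K).subtype (by
      convert hK using 1
      ext y
      constructor
      · rintro ⟨x, rfl⟩
        exact ⟨x.2.2, x.2.1⟩
      · rintro ⟨x, hx⟩
        exact ⟨⟨y, hx, x⟩, rfl⟩)
  refine not_isTopologicallyModular_of_homs hKc hKo hp (G := ℕ →₀ ZMod p) (fun x => by ext; simp)
    (T.subtype.comp a) ((T ⊓ K).subtype.comp b) (fun x hx => ha ?_) hb (fun x => (b x).2.2)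
  rw [map_zero]
  exact (QuotientAddGroup.eq_zero_iff _).2 hx

end NotModular

theorem Set.Finite.image_of_factor {α β γ : Type*} {S : Set α} {c : α → β} {g : α → γ}
    (h : (c '' S).Finite) (hcg : ∀ x ∈ S, ∀ y ∈ S, c x = c y → g x = g y) : (g '' S).Finite := by
  rcases S.eq_empty_or_nonempty with rfl | ⟨x₀, hx₀⟩
  · simp
  have : Nonempty α := ⟨x₀⟩
  refine (h.image fun q => g (Function.invFunOn c S q)).subset ?_
  rintro _ ⟨x, hx, rfl⟩
  have hex : ∃ y ∈ S, c y = c x := ⟨x, hx, rfl⟩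
  exact ⟨c x, ⟨x, hx, rfl⟩, hcg _ (Function.invFunOn_mem hex) _ hx (Function.invFunOn_eq hex)⟩

theorem Set.infinite_of_injective_subset {α : Type*} {S : Set α} {f : ℕ → Set α}
    (hf : Function.Injective f) (hS : ∀ n, f n ⊆ S) : S.Infinite := fun h =>
  (Set.infinite_of_injective_forall_mem hf (s := {t | t ⊆ S}) hS) h.finite_subsets

/-! ### Passage to quotients, and finiteness of the torsion modulo `K`. -/

section Quotient

variable {A : Type*} [AddCommGroup A]

theorem AddSubgroup.finite_of_finite_image_mk {M U : AddSubgroup A}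
    (h : ((fun x : A => (x : A ⧸ U)) '' M).Finite) (hMU : ((M ⊓ U : AddSubgroup A) : Set A).Finite) :
    (M : Set A).Finite := by
  refine Set.Finite.of_finite_fibers (fun x : A => (x : A ⧸ U)) h ?_
  rintro _ ⟨m, hm, rfl⟩
  refine (hMU.image fun y => m + y).subset ?_
  rintro x ⟨hx, hxm⟩
  refine ⟨-m + x, ⟨show -m + x ∈ M from add_mem (neg_mem hm) hx,
    QuotientAddGroup.eq.1 (Eq.symm hxm)⟩, ?_⟩
  simp

variable [TopologicalSpace A] [IsTopologicalAddGroup A]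

theorem IsCompact.finite_image_mk {K : Set A} (hK : IsCompact K) {W : AddSubgroup A}
    (hW : IsOpen (W : Set A)) : ((fun x : A => (x : A ⧸ W)) '' K).Finite := by
  obtain ⟨F, -, hF, h⟩ := hK.exists_finite_cosets hW
  refine (hF.image fun x : A => (x : A ⧸ W)).subset ?_
  rintro _ ⟨x, hx, rfl⟩
  obtain ⟨f, hf, hxf⟩ := h x hx
  exact ⟨f, hf, QuotientAddGroup.eq.2 (by rwa [neg_add_eq_sub])⟩

/-- The quotient map is open, so taking preimages commutes with closures. -/
theorem IsTopologicallyModular.quotient (h : IsTopologicallyModular A) (H : AddSubgroup A) :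
    IsTopologicallyModular (A ⧸ H) := by
  intro X Y Z hX hY hZ hXZ
  have hs := QuotientAddGroup.mk'_surjective H
  have hcl : ∀ S : AddSubgroup (A ⧸ H), S.topologicalClosure.comap (QuotientAddGroup.mk' H) =
      (S.comap (QuotientAddGroup.mk' H)).topologicalClosure := fun S => SetLike.coe_injective
    (QuotientAddGroup.isOpenMap_coe.preimage_closure_eq_closure_preimage
      QuotientAddGroup.continuous_mk _)
  have hpre : ∀ S : AddSubgroup (A ⧸ H), IsClosed (S : Set (A ⧸ H)) →
      IsClosed (S.comap (QuotientAddGroup.mk' H) : Set A) := fun S hS =>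
    hS.preimage QuotientAddGroup.continuous_mk
  apply AddSubgroup.comap_injective hs
  have := h _ _ _ (hpre X hX) (hpre Y hY) (hpre Z hZ) (AddSubgroup.comap_mono hXZ)
  rwa [AddSubgroup.comap_inf, hcl, hcl, ← AddSubgroup.comap_sup_eq _ _ _ hs,
    ← AddSubgroup.comap_sup_eq _ _ _ hs, AddSubgroup.comap_inf]

theorem NonarchimedeanAddGroup.exists_isOpen_ge_notMem {A : Type*} [AddCommGroup A]
    [TopologicalSpace A] [NonarchimedeanAddGroup A] {C : AddSubgroup A}
    (hC : IsClosed (C : Set A)) {z : A} (hz : z ∉ C) :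
    ∃ W : AddSubgroup A, IsOpen (W : Set A) ∧ C ≤ W ∧ z ∉ W := by
  have hn : (fun y => z + y) ⁻¹' (C : Set A)ᶜ ∈ 𝓝 (0 : A) :=
    (continuous_const.add continuous_id).continuousAt.preimage_mem_nhds
      (by simpa using hC.isOpen_compl.mem_nhds hz)
  obtain ⟨V, hV⟩ := NonarchimedeanAddGroup.is_nonarchimedean _ hn
  refine ⟨C ⊔ V.toAddSubgroup, AddSubgroup.isOpen_mono (le_sup_right (a := C)) V.isOpen,
    le_sup_left, fun h => ?_⟩
  obtain ⟨c, hc, v, hv, rfl⟩ := AddSubgroup.mem_sup.1 h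
  have := hV (neg_mem hv)
  simp only [Set.mem_preimage, Set.mem_compl_iff] at this
  exact this (by simpa using hc)

/-- Build strictly decreasing open `U_k` and strictly increasing finite `F_k ≤ M ⊓ U_k`, and let `H`
be the intersection of the `U_k`. It contains every `F_k`, while the images of the `U_k` keep `K /
H` infinite. -/
theorem exists_isClosed_infinite_inf_infinite_quotient {A : Type*} [AddCommGroup A]
    [TopologicalSpace A] [NonarchimedeanAddGroup A] [T2Space A]
    (hA : IsAddTorsion A) {K M : AddSubgroup A} (hKc : IsCompact (K : Set A))
    (hKo : IsOpen (K : Set A)) (hMK : M ≤ K) (hM : (M : Set A).Infinite) :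
    ∃ H : AddSubgroup A, IsClosed (H : Set A) ∧ H ≤ K ∧
      ((M ⊓ H : AddSubgroup A) : Set A).Infinite ∧ ((fun x : A => (x : A ⧸ H)) '' K).Infinite := by
  let P : AddSubgroup A × AddSubgroup A → Prop := fun s =>
    IsOpen (s.1 : Set A) ∧ s.1 ≤ K ∧ (s.2 : Set A).Finite ∧ s.2 ≤ M ⊓ s.1
  have step : ∀ s : Subtype P, ∃ t : Subtype P, t.1.1 < s.1.1 ∧ s.1.2 < t.1.2 := by
    rintro ⟨⟨U, F⟩, hUo, hUK, hF, hFM⟩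
    dsimp only at hUo hUK hF hFM ⊢
    have hMU : ((M ⊓ U : AddSubgroup A) : Set A).Infinite := fun h => hM
      (AddSubgroup.finite_of_finite_image_mk
        ((hKc.finite_image_mk hUo).subset (Set.image_mono hMK)) h)
    obtain ⟨y, hy, hyF⟩ := hMU.exists_notMem_finite hF
    let F' := AddSubgroup.closure (insert y (F : Set A))
    have hF' : (F' : Set A).Finite := hA.finite_closure (hF.insert y)
    have hF'M : F' ≤ M ⊓ U :=
      (AddSubgroup.closure_le _).2 (Set.insert_subset hy hFM)
    obtain ⟨z, hz, hzF⟩ := hMU.exists_notMem_finite hF'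
    obtain ⟨W, hWo, hFW, hzW⟩ :=
      NonarchimedeanAddGroup.exists_isOpen_ge_notMem hF'.isClosed hzF
    refine ⟨⟨(U ⊓ W, F'), hUo.inter hWo, inf_le_left.trans hUK, hF',
      le_inf (hF'M.trans inf_le_left) (le_inf (hF'M.trans inf_le_right) hFW)⟩, ?_, ?_⟩
    · refine lt_of_le_of_ne inf_le_left fun h => hzW ?_
      have hzU : z ∈ U := hz.2
      have h' : U ⊓ W = U := h
      rw [← h'] at hzU
      exact hzU.2
    · refine lt_of_le_of_ne (fun x hx => AddSubgroup.subset_closure (Or.inr hx)) fun h => hyF ?_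
      have : y ∈ F' := AddSubgroup.subset_closure (Or.inl rfl)
      have h' : F = F' := h
      rwa [← h'] at this
  choose next hnext using step
  let s₀ : Subtype P := ⟨(K, ⊥), hKo, le_rfl, by simp, bot_le⟩
  let s : ℕ → Subtype P := fun k => next^[k] s₀
  have hs : ∀ k, s (k + 1) = next (s k) := fun k => Function.iterate_succ_apply' next k s₀
  have hU : StrictAnti fun k => (s k).1.1 := strictAnti_nat_of_succ_lt fun k => by
    rw [hs]; exact (hnext _).1
  have hF : StrictMono fun k => (s k).1.2 := strictMono_nat_of_lt_succ fun k => by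
    rw [hs]; exact (hnext _).2
  set H : AddSubgroup A := ⨅ k, (s k).1.1 with hH
  have hHle : ∀ k, H ≤ (s k).1.1 := fun k => iInf_le _ k
  refine ⟨H, ?_, (hHle 0).trans (s 0).2.2.1, ?_, ?_⟩
  · rw [hH, AddSubgroup.coe_iInf]
    exact isClosed_iInter fun k => AddSubgroup.isClosed_of_isOpen _ (s k).2.1
  · refine Set.infinite_of_injective_subset (f := fun k => ((s k).1.2 : Set A))
      (fun i j hij => hF.injective (SetLike.coe_injective hij)) fun k => ?_
    refine (le_inf ((s k).2.2.2.2.trans inf_le_left) (le_iInf fun j => ?_) : (s k).1.2 ≤ M ⊓ H)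
    calc (s k).1.2 ≤ (s (max j k)).1.2 := hF.monotone (le_max_right _ _)
      _ ≤ (s (max j k)).1.1 := (s (max j k)).2.2.2.2.trans inf_le_right
      _ ≤ (s j).1.1 := hU.antitone (le_max_left _ _)
  · refine Set.infinite_of_injective_subset
      (f := fun k => (fun x : A => (x : A ⧸ H)) '' ((s k).1.1 : Set A)) (fun i j hij => ?_)
      fun k => Set.image_mono (s k).2.2.1
    refine hU.injective (?_ : (s i).1.1 = (s j).1.1)
    have hcomap : ∀ k, (s k).1.1 =
        (((s k).1.1).map (QuotientAddGroup.mk' H)).comap (QuotientAddGroup.mk' H) := fun k => by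
      rw [AddSubgroup.comap_map_eq, QuotientAddGroup.ker_mk', sup_eq_left.2 (hHle k)]
    rw [hcomap i, hcomap j]
    congr 1
    exact SetLike.coe_injective hij

/-- In a topologically modular group with infinite `p`-torsion in the compact open subgroup `K`, the
`p`-torsion of the quotient by `K` is finite. -/
theorem IsTopologicallyModular.finite_torsion_quotient [LocallyCompactSpace A] [T2Space A]
    (hmod : IsTopologicallyModular A) (hA : IsAddTorsion A) {K : AddSubgroup A}
    (hKc : IsCompact (K : Set A)) (hKo : IsOpen (K : Set A)) {p : ℕ} (hp : p.Prime)
    (hK : {x | x ∈ K ∧ p • x = 0}.Infinite) :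
    ((fun x : A => (x : A ⧸ K)) '' {x | p • x ∈ K}).Finite := by
  by_contra hinf
  have hT : ((fun x : A => (x : A ⧸ K)) '' {x | p • x = 0}).Finite := by
    by_contra h
    exact not_isTopologicallyModular_of_infinite hKc hKo hp hK h hmod
  set E : AddSubgroup A := K.comap (nsmulAddMonoidHom p) with hE
  set C : AddSubgroup A := K.map (nsmulAddMonoidHom p) with hC
  have hCK : C ≤ K := by
    rintro _ ⟨x, hx, rfl⟩
    exact nsmul_mem hx p
  have hCc : IsClosed (C : Set A) := (hKc.image (continuous_nsmul p)).isClosed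
  -- Multiplication by `p`, modulo `C = pK`; its value depends only on the class modulo `K`.
  set g : A →+ A ⧸ C := (QuotientAddGroup.mk' C).comp (nsmulAddMonoidHom p) with hg
  have hgeq : ∀ x y : A, x - y ∈ K → g x = g y := fun x y hxy => by
    rw [← sub_eq_zero, ← map_sub]
    exact (QuotientAddGroup.eq_zero_iff _).2 ⟨x - y, hxy, rfl⟩
  set M : AddSubgroup (A ⧸ C) := E.map g with hM
  set KC : AddSubgroup (A ⧸ C) := K.map (QuotientAddGroup.mk' C) with hKC
  -- The kernel of `g` is `K + A[p]`, which is finite modulo `K` by `hT`, whereas `E` is infinite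
  -- modulo `K`.
  have hMinf : (M : Set (A ⧸ C)).Infinite := by
    intro hMfin
    choose! r hr using fun (m : A ⧸ C) (hm : m ∈ M) => hm
    apply hinf
    refine (((hMfin.image r).image fun x : A => (x : A ⧸ K)).add hT).subset ?_
    rintro _ ⟨x, hx, rfl⟩
    have hgx : g x ∈ M := ⟨x, hx, rfl⟩
    have h0 : g (x - r (g x)) = 0 := by rw [map_sub, (hr _ hgx).2, sub_self]
    obtain ⟨k, hk, hkx⟩ := (QuotientAddGroup.eq_zero_iff _).1 h0
    change p • k = p • (x - r (g x)) at hkx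
    refine ⟨_, ⟨_, ⟨_, hgx, rfl⟩, rfl⟩, _, ⟨x - r (g x) - k, ?_, rfl⟩, ?_⟩
    · change p • _ = 0
      rw [smul_sub, ← hkx, sub_self]
    · change ((r (g x) + (x - r (g x) - k) : A) : A ⧸ K) = x
      refine QuotientAddGroup.eq.2 ?_
      rwa [show -(r (g x) + (x - r (g x) - k)) + x = k by abel]
  have hKCo : IsOpen (KC : Set (A ⧸ C)) := QuotientAddGroup.isOpenMap_coe _ hKo
  have hKCc : IsCompact (KC : Set (A ⧸ C)) := hKc.image QuotientAddGroup.continuous_mk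
  have hMKC : M ≤ KC := by
    rintro _ ⟨x, hx, rfl⟩
    exact ⟨p • x, hx, rfl⟩
  have : T3Space (A ⧸ C) := inferInstance
  have htors : IsAddTorsion (A ⧸ C) :=
    IsAddTorsion.of_surjective (QuotientAddGroup.mk'_surjective C) hA
  have := htors.nonarchimedeanAddGroup
  obtain ⟨H, hHc, hHK, hMH, hKH⟩ :=
    exists_isClosed_infinite_inf_infinite_quotient htors hKCc hKCo hMKC hMinf
  set KH : AddSubgroup ((A ⧸ C) ⧸ H) := KC.map (QuotientAddGroup.mk' H) with hKHdef
  have hpK : ∀ x ∈ KC, p • x = 0 := by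
    rintro _ ⟨x, hx, rfl⟩
    exact (QuotientAddGroup.eq_zero_iff _).2 ⟨x, hx, rfl⟩
  have : T3Space ((A ⧸ C) ⧸ H) := inferInstance
  -- In `(A / C) / H` the compact open group `KH` is infinite and killed by `p`. Elements `x ∈ E`
  -- with `g x ∈ H` become `p`-torsion there, and their classes modulo `KH` determine `g x`, so they
  -- form an infinite set because `M ⊓ H` is infinite.
  refine not_isTopologicallyModular_of_infinite (K := KH)
    (hKCc.image QuotientAddGroup.continuous_mk) (QuotientAddGroup.isOpenMap_coe _ hKCo) hp
    (hKH.mono ?_) (fun hfin => hMH ?_) ((hmod.quotient C).quotient H)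
  · rintro _ ⟨x, hx, rfl⟩
    refine ⟨⟨x, hx, rfl⟩, ?_⟩
    rw [← QuotientAddGroup.mk_nsmul, hpK x hx, QuotientAddGroup.mk_zero]
  · have hS : ((M ⊓ H : AddSubgroup (A ⧸ C)) : Set (A ⧸ C)) ⊆ g '' {x | x ∈ E ∧ g x ∈ H} := by
      rintro _ ⟨⟨x, hx, rfl⟩, hxH⟩
      exact ⟨x, ⟨hx, hxH⟩, rfl⟩
    refine Set.Finite.subset (Set.Finite.image_of_factor (c := fun x : A =>
      (((x : A ⧸ C) : (A ⧸ C) ⧸ H) : ((A ⧸ C) ⧸ H) ⧸ KH)) (hfin.subset ?_) ?_) hS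
    · rintro _ ⟨x, ⟨hx, hxH⟩, rfl⟩
      refine ⟨_, ?_, rfl⟩
      exact (QuotientAddGroup.eq_zero_iff _).2 hxH
    · intro x _ y _ hxy
      apply hgeq
      obtain ⟨w, hw, hkxy⟩ := QuotientAddGroup.eq.1 hxy.symm
      have h2 := hHK (QuotientAddGroup.eq.1 hkxy)
      obtain ⟨k', hk', hkk⟩ := add_mem (show w ∈ KC from hw) h2
      rw [add_neg_cancel_left] at hkk
      have h3 := hCK (QuotientAddGroup.eq.1 hkk)
      have h4 : -y + x ∈ K := by
        have := add_mem hk' h3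
        rwa [add_neg_cancel_left] at this
      rwa [neg_add_eq_sub] at h4

end Quotient

/-! ### Primary components of torsion groups. -/

section PrimaryComponents

variable {A : Type*} [AddCommGroup A]

theorem Nat.exists_mul_eq_of_primes (σ : Set ℕ) {m : ℕ} (hm : m ≠ 0) :
    ∃ a b : ℕ, a * b = m ∧ (∀ q, q.Prime → q ∣ a → q ∈ σ) ∧ (∀ q, q.Prime → q ∣ b → q ∉ σ) := by
  induction m using Nat.recOnMul with
  | zero => exact absurd rfl hm
  | one =>
    refine ⟨1, 1, rfl, fun q hq h => ?_, fun q hq h => ?_⟩ <;>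
    exact absurd (Nat.dvd_one.1 h) hq.ne_one
  | prime p hp =>
    by_cases h : p ∈ σ
    · refine ⟨p, 1, mul_one p, fun q hq hqp => ?_, fun q hq h => ?_⟩
      · rwa [(Nat.prime_dvd_prime_iff_eq hq hp).1 hqp]
      · exact absurd (Nat.dvd_one.1 h) hq.ne_one
    · refine ⟨1, p, one_mul p, fun q hq h => ?_, fun q hq hqp => ?_⟩
      · exact absurd (Nat.dvd_one.1 h) hq.ne_one
      · rwa [(Nat.prime_dvd_prime_iff_eq hq hp).1 hqp]
  | mul x y hx hy =>
    obtain ⟨a, b, hab, ha, hb⟩ := hx (left_ne_zero_of_mul hm)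
    obtain ⟨a', b', hab', ha', hb'⟩ := hy (right_ne_zero_of_mul hm)
    refine ⟨a * a', b * b', by rw [← hab, ← hab']; ring, fun q hq h => ?_, fun q hq h => ?_⟩
    · exact ((Nat.Prime.dvd_mul hq).1 h).elim (ha q hq) (ha' q hq)
    · exact ((Nat.Prime.dvd_mul hq).1 h).elim (hb q hq) (hb' q hq)

theorem Nat.coprime_of_primes {σ : Set ℕ} {a b : ℕ} (ha : ∀ q, q.Prime → q ∣ a → q ∈ σ)
    (hb : ∀ q, q.Prime → q ∣ b → q ∉ σ) : a.Coprime b :=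
  Nat.coprime_of_dvd fun q hq hqa hqb => hb q hq hqb (ha q hq hqa)

theorem eq_zero_of_coprime_nsmul {a b : ℕ} (hab : a.Coprime b) {x : A} (ha : a • x = 0)
    (hb : b • x = 0) : x = 0 := by
  rw [← AddMonoid.addOrderOf_eq_one_iff, ← Nat.dvd_one, ← hab]
  exact Nat.dvd_gcd (addOrderOf_dvd_of_nsmul_eq_zero ha) (addOrderOf_dvd_of_nsmul_eq_zero hb)

/-- The element `x` is a sum of multiples of itself killed by `a` and `b`. -/
theorem exists_add_eq_of_coprime_nsmul {a b : ℕ} (hab : a.Coprime b) {x : A}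
    (hx : (a * b) • x = 0) : ∃ c d : ℤ, x = c • x + d • x ∧ a • c • x = 0 ∧ b • d • x = 0 := by
  obtain ⟨u, w, huw⟩ := Nat.isCoprime_iff_coprime.2 hab
  refine ⟨w * b, u * a, ?_, ?_, ?_⟩
  · rw [← add_smul, add_comm, huw, one_smul]
  · rw [← natCast_zsmul, ← mul_smul, show (a : ℤ) * (w * b) = w * (a * b : ℕ) by push_cast; ring,
      mul_smul, natCast_zsmul, hx, smul_zero]
  · rw [← natCast_zsmul, ← mul_smul, show (b : ℤ) * (u * a) = u * (a * b : ℕ) by push_cast; ring,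
      mul_smul, natCast_zsmul, hx, smul_zero]

variable (A) in
/-- The elements whose order is divisible by primes in `σ` only. -/
def primePart (σ : Set ℕ) : AddSubgroup A where
  carrier := {x | ∃ m : ℕ, m ≠ 0 ∧ (∀ q, q.Prime → q ∣ m → q ∈ σ) ∧ m • x = 0}
  zero_mem' := ⟨1, one_ne_zero, fun q hq h => absurd (Nat.dvd_one.1 h) hq.ne_one, smul_zero 1⟩
  add_mem' := by
    rintro x y ⟨m, hm, hmσ, hmx⟩ ⟨n, hn, hnσ, hny⟩
    refine ⟨m * n, mul_ne_zero hm hn, fun q hq h => ?_, ?_⟩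
    · exact ((Nat.Prime.dvd_mul hq).1 h).elim (hmσ q hq) (hnσ q hq)
    · rw [smul_add, mul_smul, mul_smul, hny, smul_zero, add_zero, smul_comm, hmx, smul_zero]
  neg_mem' := by
    rintro x ⟨m, hm, hmσ, hmx⟩
    exact ⟨m, hm, hmσ, by rw [smul_neg, hmx, neg_zero]⟩

theorem eq_zero_of_mem_primePart {σ τ : Set ℕ} (h : Disjoint σ τ) {x : A} (hσ : x ∈ primePart A σ)
    (hτ : x ∈ primePart A τ) : x = 0 := by
  obtain ⟨m, _, hmσ, hmx⟩ := hσ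
  obtain ⟨n, _, hnτ, hnx⟩ := hτ
  exact eq_zero_of_coprime_nsmul (Nat.coprime_of_primes hmσ fun q hq hqn hqσ =>
    Set.disjoint_left.1 h hqσ (hnτ q hq hqn)) hmx hnx

theorem primePart_mono {σ τ : Set ℕ} (h : σ ⊆ τ) : primePart A σ ≤ primePart A τ :=
  fun _ ⟨m, hm, hmσ, hmx⟩ => ⟨m, hm, fun q hq hqm => h (hmσ q hq hqm), hmx⟩

theorem IsAddTorsion.exists_add_primePart (hA : IsAddTorsion A) (σ : Set ℕ) {X : AddSubgroup A}
    {x : A} (hx : x ∈ X) : ∃ y ∈ X, ∃ z ∈ X, x = y + z ∧ y ∈ primePart A σ ∧ z ∈ primePart A σᶜ := by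
  obtain ⟨m, hm, hmx⟩ := isOfFinAddOrder_iff_nsmul_eq_zero.1 (hA x)
  obtain ⟨a, b, rfl, ha, hb⟩ := Nat.exists_mul_eq_of_primes σ hm.ne'
  obtain ⟨c, d, hcd, hc, hd⟩ := exists_add_eq_of_coprime_nsmul (Nat.coprime_of_primes ha hb) hmx
  exact ⟨c • x, X.zsmul_mem hx c, d • x, X.zsmul_mem hx d, hcd,
    ⟨a, (Nat.pos_of_mul_pos_right hm).ne', ha, hc⟩, ⟨b, (Nat.pos_of_mul_pos_left hm).ne', hb, hd⟩⟩

theorem mem_primePart_singleton {p : ℕ} (hp : p.Prime) {x : A} :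
    x ∈ primePart A {p} ↔ ∃ k : ℕ, p ^ k • x = 0 := by
  constructor
  · rintro ⟨m, hm, hmp, hmx⟩
    exact ⟨_, (Nat.eq_prime_pow_of_unique_prime_dvd hm fun {q} hq h => hmp q hq h) ▸ hmx⟩
  · rintro ⟨k, hk⟩
    exact ⟨p ^ k, pow_ne_zero k hp.ne_zero, fun q hq h =>
      (Nat.prime_dvd_prime_iff_eq hq hp).1 (hq.dvd_of_dvd_pow h), hk⟩

theorem primePart_inf_eq_iSup (σ : Set ℕ) (X : AddSubgroup A) :
    X ⊓ primePart A σ = ⨆ p ∈ σ, X ⊓ primePart A {p} := by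
  refine le_antisymm ?_ (iSup₂_le fun p hp =>
    inf_le_inf_left _ (primePart_mono (Set.singleton_subset_iff.2 hp)))
  suffices key : ∀ m : ℕ, m ≠ 0 → (∀ q, q.Prime → q ∣ m → q ∈ σ) → ∀ x ∈ X, m • x = 0 →
      x ∈ ⨆ p ∈ σ, X ⊓ primePart A {p} by
    rintro x ⟨hxX, m, hm, hmσ, hmx⟩
    exact key m hm hmσ x hxX hmx
  intro m
  induction m using Nat.recOnPosPrimePosCoprime with
  | prime_pow p k hp hk =>
    intro hm hmσ x hxX hmx
    have hpσ : p ∈ σ := hmσ p hp (dvd_pow_self p hk.ne')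
    exact AddSubgroup.mem_iSup_of_mem p (AddSubgroup.mem_iSup_of_mem hpσ
      ⟨hxX, (mem_primePart_singleton hp).2 ⟨k, hmx⟩⟩)
  | zero => exact fun hm => absurd rfl hm
  | one =>
    intro hm hmσ x hxX hmx
    rw [one_smul] at hmx
    rw [hmx]
    exact zero_mem _
  | coprime a b ha hb hab iha ihb =>
    intro hm hmσ x hxX hmx
    obtain ⟨c, d, hcd, hc, hd⟩ := exists_add_eq_of_coprime_nsmul hab hmx
    rw [hcd]
    exact add_mem
      (iha (by lia) (fun q hq h => hmσ q hq (h.mul_right b)) _ (X.zsmul_mem hxX c) hc)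
      (ihb (by lia) (fun q hq h => hmσ q hq (h.mul_left a)) _ (X.zsmul_mem hxX d) hd)

variable [TopologicalSpace A] [IsTopologicalAddGroup A] [T2Space A]

/-- The multiples of `x` form a finite, hence discrete, group, so `p ^ k • x → 0` means that `p ^ k
• x` vanishes eventually. -/
theorem IsAddTorsion.primaryComponent_eq (hA : IsAddTorsion A) {p : ℕ} (hp : p.Prime) :
    primaryComponent A p = primePart A {p} := by
  ext x
  rw [mem_primePart_singleton hp]
  constructor
  · intro hx
    have hfin : ((AddSubgroup.zmultiples x : Set A) \ {0}).Finite :=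
      (finite_zmultiples.2 (hA x)).subset Set.sdiff_subset
    have hU : ((AddSubgroup.zmultiples x : Set A) \ {0})ᶜ ∈ 𝓝 (0 : A) :=
      hfin.isClosed.isOpen_compl.mem_nhds (by simp)
    obtain ⟨k, hk⟩ := (Tendsto.eventually (show Tendsto (fun k : ℕ => p ^ k • x) atTop (𝓝 0) from hx)
      hU).exists
    refine ⟨k, ?_⟩
    by_contra h
    exact hk ⟨nsmul_mem (AddSubgroup.mem_zmultiples x) _, h⟩
  · rintro ⟨k, hk⟩
    change Tendsto (fun k : ℕ => p ^ k • x) atTop (𝓝 0)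
    refine tendsto_const_nhds.congr' ?_
    filter_upwards [eventually_ge_atTop k] with j hj
    obtain ⟨i, rfl⟩ := Nat.exists_eq_add_of_le hj
    rw [pow_add, mul_comm, mul_smul, hk, smul_zero]

/-- Inside the open subgroup killed by `m`, the `σ`-part is the kernel of the `σ`-part `a` of `m`.
-/
theorem IsAddTorsion.isClosed_primePart [LocallyCompactSpace A] (hA : IsAddTorsion A) (σ : Set ℕ) :
    IsClosed (primePart A σ : Set A) := by
  obtain ⟨m, hm, hmo⟩ := hA.exists_isOpen_ker_nsmul
  obtain ⟨a, b, hab, ha, hb⟩ := Nat.exists_mul_eq_of_primes σ hm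
  refine AddSubgroup.isClosed_of_isClosed_inf hmo ?_
  have : primePart A σ ⊓ (nsmulAddMonoidHom m : A →+ A).ker = (nsmulAddMonoidHom a : A →+ A).ker := by
    ext x
    constructor
    · rintro ⟨⟨n, hn, hnσ, hnx⟩, hmx⟩
      change m • x = 0 at hmx
      rw [← hab, mul_comm, mul_smul] at hmx
      exact eq_zero_of_coprime_nsmul (Nat.coprime_of_primes hnσ hb)
        (show n • a • x = 0 by rw [smul_comm, hnx, smul_zero]) hmx
    · intro hx
      change a • x = 0 at hx
      refine ⟨⟨a, fun h => hm (by rw [← hab, h, zero_mul]), ha, hx⟩, ?_⟩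
      change m • x = 0
      rw [← hab, mul_comm, mul_smul, hx, smul_zero]
  rw [this]
  exact isClosed_singleton.preimage (continuous_nsmul a)

theorem IsAddTorsion.primaryComponentOfSet_eq [LocallyCompactSpace A] (hA : IsAddTorsion A)
    {σ : Set ℕ} (hσ : ∀ p ∈ σ, p.Prime) : primaryComponentOfSet A σ = primePart A σ := by
  have h : ⨆ p ∈ σ, primaryComponent A p = primePart A σ := by
    have := primePart_inf_eq_iSup (A := A) σ ⊤
    rw [top_inf_eq] at this
    rw [this]
    refine iSup_congr fun p => iSup_congr fun hp => ?_
    rw [top_inf_eq, hA.primaryComponent_eq (hσ p hp)]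
  rw [primaryComponentOfSet, h]
  exact le_antisymm (AddSubgroup.topologicalClosure_minimal _ le_rfl (hA.isClosed_primePart σ))
    (AddSubgroup.le_topologicalClosure _)

theorem IsAddTorsion.exists_nsmul_eq_zero_of_finite {A : Type*} [AddCommGroup A]
    (hA : IsAddTorsion A) {F : Set A} (hF : F.Finite) : ∃ m : ℕ, m ≠ 0 ∧ ∀ x ∈ F, m • x = 0 :=
  ⟨∏ x ∈ hF.toFinset, addOrderOf x,
    Finset.prod_ne_zero_iff.2 fun x _ => (addOrderOf_pos_iff.2 (hA x)).ne', fun _ hx =>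
    addOrderOf_dvd_iff_nsmul_eq_zero.1 (Finset.dvd_prod_of_mem _ (hF.mem_toFinset.2 hx))⟩

theorem IsAddTorsion.exists_nsmul_eq_zero_of_isCompact [LocallyCompactSpace A]
    (hA : IsAddTorsion A) {K : Set A} (hK : IsCompact K) :
    ∃ m : ℕ, m ≠ 0 ∧ ∀ x ∈ K, m • x = 0 := by
  obtain ⟨n, hn, hno⟩ := hA.exists_isOpen_ker_nsmul
  obtain ⟨F, -, hF, h⟩ := hK.exists_finite_cosets hno
  obtain ⟨m, hm, hmF⟩ := hA.exists_nsmul_eq_zero_of_finite hF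
  refine ⟨m * n, mul_ne_zero hm hn, fun x hx => ?_⟩
  obtain ⟨f, hf, hxf⟩ := h x hx
  change n • (x - f) = 0 at hxf
  rw [← sub_add_cancel x f, smul_add, mul_smul, hxf, smul_zero, zero_add, mul_comm, mul_smul,
    hmF f hf, smul_zero]

end PrimaryComponents

/-! ### Finite rank. -/

section Rank

variable {A : Type*} [AddCommGroup A]

theorem AddSubgroup.topologicalClosure_eq_self_of_discrete {G : Type*} [AddCommGroup G]
    [TopologicalSpace G] [IsTopologicalAddGroup G] [DiscreteTopology G] (H : AddSubgroup G) :
    H.topologicalClosure = H :=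
  le_antisymm (H.topologicalClosure_minimal le_rfl (isClosed_discrete _)) H.le_topologicalClosure

theorem hasFinitePRank_iff_of_discrete [TopologicalSpace A] [IsTopologicalAddGroup A]
    (S : AddSubgroup A) [DiscreteTopology S] :
    HasFinitePRank S ↔ ∃ r : ℕ, ∀ F : Finset A, (F : Set A) ⊆ S → ∃ E : Finset A, E.card ≤ r ∧
      AddSubgroup.closure (E : Set A) = AddSubgroup.closure (F : Set A) := by
  classical
  simp only [HasFinitePRank, AddSubgroup.topologicalClosure_eq_self_of_discrete]
  refine exists_congr fun r => ⟨fun h F hF => ?_, fun h F => ?_⟩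
  · obtain ⟨E, hE, hEF⟩ := h (F.preimage Subtype.val Subtype.val_injective.injOn)
    refine ⟨E.image Subtype.val, Finset.card_image_le.trans hE, ?_⟩
    have := congrArg (AddSubgroup.map S.subtype) hEF
    rw [AddMonoidHom.map_closure, AddMonoidHom.map_closure] at this
    rw [Finset.coe_image]
    refine this.trans ?_
    rw [Finset.coe_preimage, AddSubgroup.coe_subtype,
      Set.image_preimage_eq_of_subset (by rwa [Subtype.range_coe])]
  · obtain ⟨E, hE, hEF⟩ := h (F.image Subtype.val) (by
      rw [Finset.coe_image]
      rintro _ ⟨x, _, rfl⟩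
      exact x.2)
    have hES : (E : Set A) ⊆ S := by
      have h1 : (E : Set A) ⊆ AddSubgroup.closure (E : Set A) := AddSubgroup.subset_closure
      rw [hEF] at h1
      refine h1.trans ((AddSubgroup.closure_le S).2 ?_)
      rw [Finset.coe_image]
      rintro _ ⟨x, _, rfl⟩
      exact x.2
    refine ⟨E.preimage Subtype.val Subtype.val_injective.injOn, ?_, ?_⟩
    · refine (Finset.card_le_card_of_injOn Subtype.val (fun x hx => ?_)
        Subtype.val_injective.injOn).trans hE
      simpa using hx
    · apply AddSubgroup.map_injective S.subtype_injective
      rw [AddMonoidHom.map_closure, AddMonoidHom.map_closure, Finset.coe_preimage,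
        AddSubgroup.coe_subtype, Set.image_preimage_eq_of_subset (by rwa [Subtype.range_coe]), hEF,
        Finset.coe_image]

theorem card_closure_le_of_nsmul_eq_zero {Q : Type*} [AddCommGroup Q] {m : ℕ} (hm : m ≠ 0)
    (E : Finset Q) (hE : ∀ x ∈ E, m • x = 0) :
    (AddSubgroup.closure (E : Set Q) : Set Q).encard ≤ (m ^ E.card : ℕ) := by
  classical
  have : NeZero m := ⟨hm⟩
  let H : AddSubgroup Q := (nsmulAddMonoidHom m : Q →+ Q).ker
  have hH : ∀ x : H, m • x = 0 := fun x => Subtype.ext x.2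
  let _ : Module (ZMod m) H := AddCommGroup.zmodModule hH
  let f : (E → ZMod m) →ₗ[ZMod m] H :=
    Fintype.linearCombination (ZMod m) fun e : E => (⟨e, hE e e.2⟩ : H)
  have hle : AddSubgroup.closure (E : Set Q) ≤ (H.subtype.comp f.toAddMonoidHom).range := by
    rw [AddSubgroup.closure_le]
    intro e he
    refine ⟨Pi.single ⟨e, he⟩ 1, ?_⟩
    simp [f, Fintype.linearCombination_apply_single]
  calc _ ≤ (Set.range (H.subtype.comp f.toAddMonoidHom)).encard := Set.encard_le_encard hle
    _ ≤ (Set.univ : Set (E → ZMod m)).encard := by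
      rw [← Set.image_univ]; exact Set.encard_image_le _ _
    _ = _ := by
      rw [Set.encard_univ, ENat.card_eq_coe_fintype_card]
      simp [ZMod.card]

/-- A quotient of bounded exponent of a group of finite rank is finite. -/
theorem finite_image_of_finite_rank {Q : Type*} [AddCommGroup Q] {m r : ℕ} (hm : m ≠ 0)
    (S : AddSubgroup A) (hS : ∀ F : Finset A, (F : Set A) ⊆ S → ∃ E : Finset A, E.card ≤ r ∧
      AddSubgroup.closure (E : Set A) = AddSubgroup.closure (F : Set A)) (f : A →+ Q)
    (hf : ∀ x ∈ S, m • f x = 0) : (f '' S).Finite := by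
  classical
  by_contra hinf
  -- A group killed by `m` with `r` generators has at most `m ^ r` elements, so `m ^ r + 1` values
  -- are too many.
  obtain ⟨t, htS, htc⟩ := Set.Infinite.exists_subset_card_eq hinf (m ^ r + 1)
  obtain ⟨F, hFS, rfl⟩ := Finset.subset_set_image_iff.1 htS
  obtain ⟨E, hE, hEF⟩ := hS F hFS
  have hclS : AddSubgroup.closure (E : Set A) ≤ S := hEF ▸ (AddSubgroup.closure_le S).2 hFS
  have h1 := card_closure_le_of_nsmul_eq_zero hm (E.image f) (by
    intro y hy
    obtain ⟨x, hx, rfl⟩ := Finset.mem_image.1 hy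
    exact hf x (hclS (AddSubgroup.subset_closure hx)))
  have h2 : ((F.image f : Finset Q) : Set Q) ⊆
      AddSubgroup.closure ((E.image f : Finset Q) : Set Q) := by
    rw [Finset.coe_image, Finset.coe_image, ← AddMonoidHom.map_closure, hEF,
      AddMonoidHom.map_closure]
    exact AddSubgroup.subset_closure
  have h3 := (Set.encard_le_encard h2).trans h1
  rw [Set.encard_coe_eq_coe_finsetCard, htc, Nat.cast_le] at h3
  have : m ^ (E.image f).card ≤ m ^ r :=
    Nat.pow_le_pow_right (Nat.pos_of_ne_zero hm) (Finset.card_image_le.trans hE)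
  omega

end Rank

/-! ### Closedness of sums of closed subgroups. -/

section Quasihamiltonian

variable {A : Type*} [AddCommGroup A] [TopologicalSpace A] [IsTopologicalAddGroup A]

theorem IsStronglyTopologicallyQuasihamiltonian.isTopologicallyModular
    (h : IsStronglyTopologicallyQuasihamiltonian A) : IsTopologicallyModular A := by
  have hcl : ∀ S : AddSubgroup A, IsClosed (S : Set A) → S.topologicalClosure = S := fun S hS =>
    le_antisymm (S.topologicalClosure_minimal le_rfl hS) S.le_topologicalClosure
  intro X Y Z hX hY hZ hXZ
  rw [hcl _ (h X (Y ⊓ Z) hX (hY.inter hZ)), hcl _ (h X Y hX hY), sup_inf_assoc_of_le Y hXZ]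

theorem finite_image_iSup {A Q ι : Type*} [AddCommGroup A] [AddCommGroup Q] {s : Set ι}
    (hs : s.Finite) (G : ι → AddSubgroup A) (f : A →+ Q) (h : ∀ i ∈ s, (f '' G i).Finite) :
    (f '' (⨆ i ∈ s, G i : AddSubgroup A)).Finite := by
  have key : (((⨆ i ∈ s, (G i).map f : AddSubgroup Q)) : Set Q).Finite := by
    induction s, hs using Set.Finite.induction_on with
    | empty => simp
    | insert _ _ ih =>
      rw [iSup_insert, AddSubgroup.add_normal]
      exact (h _ (Set.mem_insert _ _)).add (ih fun i hi => h i (Set.mem_insert_of_mem _ hi))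
  have : (⨆ i ∈ s, G i : AddSubgroup A).map f = ⨆ i ∈ s, (G i).map f := by
    simp_rw [AddSubgroup.map_iSup]
  rw [← this] at key
  exact key

variable [LocallyCompactSpace A] [T2Space A]

theorem IsAddTorsion.isStronglyTopologicallyQuasihamiltonian (hA : IsAddTorsion A) {φ : Set ℕ}
    (hφp : ∀ p ∈ φ, p.Prime) (hφ : φ.Finite) {D V : AddSubgroup A}
    (hDV : D ⊔ V = primaryComponentOfSet A φ) [DiscreteTopology D]
    (hD : ∀ p ∈ φ, HasFinitePRank (D ⊓ primaryComponent A p : AddSubgroup A))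
    (hVc : IsCompact (V : Set A)) (hVo : IsOpen (V : Set A)) :
    IsStronglyTopologicallyQuasihamiltonian A := by
  intro X Y hX hY
  rw [hA.primaryComponentOfSet_eq hφp] at hDV
  have hDφ : D ≤ primePart A φ := hDV ▸ le_sup_left
  have hVφ : V ≤ primePart A φ := hDV ▸ le_sup_right
  obtain ⟨m, hm, hmV⟩ := hA.exists_nsmul_eq_zero_of_isCompact hVc
  -- The possible `D`-components `d` of `x` when `x + y ∈ V`. As `m` kills `V`, the elements `xF d ∈
  -- X` and `yF d ∈ Y` congruent to `d` modulo `V` satisfy `m • xF d = m • d = m • yF d`.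
  set E : AddSubgroup A := D ⊓ (X ⊔ V) ⊓ (Y ⊔ V) with hE
  have hED : E ≤ D := inf_le_left.trans inf_le_left
  let N := E.map (nsmulAddMonoidHom m)
  have hEfin : (QuotientAddGroup.mk' N '' E).Finite := by
    have hEφ : E = ⨆ p ∈ φ, E ⊓ primePart A {p} := by
      rw [← primePart_inf_eq_iSup, inf_eq_left.2 (hED.trans hDφ)]
    have : ∀ p ∈ φ, (QuotientAddGroup.mk' N '' (E ⊓ primePart A {p} : AddSubgroup A)).Finite := by
      intro p hp
      have hdisc : DiscreteTopology (D ⊓ primaryComponent A p : AddSubgroup A) :=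
        DiscreteTopology.of_subset (s := (D : Set A)) ‹_› Set.inter_subset_left
      obtain ⟨r, hr⟩ := (hasFinitePRank_iff_of_discrete _).1 (hD p hp)
      refine finite_image_of_finite_rank (r := r) hm _ (fun F hF => hr F (hF.trans ?_)) _ ?_
      · rw [hA.primaryComponent_eq (hφp p hp)]
        exact Set.inter_subset_inter_left _ hED
      · intro x hx
        rw [← map_nsmul]
        exact (QuotientAddGroup.eq_zero_iff _).2 ⟨x, hx.1, rfl⟩
    have h := finite_image_iSup hφ _ _ this
    rwa [← hEφ] at h
  obtain ⟨F, hFE, hFim⟩ := Set.exists_subset_bijOn (E : Set A) (QuotientAddGroup.mk' N)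
  have hF : F.Finite := Set.Finite.of_finite_image (by rwa [hFim.image_eq]) hFim.injOn
  choose! xF hxF using fun (d : A) (hd : d ∈ E) => AddSubgroup.mem_sup.1 hd.1.2
  choose! yF hyF using fun (d : A) (hd : d ∈ E) => AddSubgroup.mem_sup.1 hd.2
  have hx : ∀ d ∈ E, xF d ∈ X ∧ xF d - d ∈ V := fun d hd => by
    obtain ⟨h1, v, hv, h2⟩ := hxF d hd
    refine ⟨h1, ?_⟩
    have : xF d - d = -v := by
      rwa [sub_eq_iff_eq_add, neg_add_eq_sub, eq_sub_iff_add_eq]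
    exact this ▸ neg_mem hv
  have hy : ∀ d ∈ E, yF d ∈ Y ∧ yF d - d ∈ V := fun d hd => by
    obtain ⟨h1, v, hv, h2⟩ := hyF d hd
    refine ⟨h1, ?_⟩
    have : yF d - d = -v := by
      rwa [sub_eq_iff_eq_add, neg_add_eq_sub, eq_sub_iff_add_eq]
    exact this ▸ neg_mem hv
  have hmul : ∀ z d : A, z - d ∈ V → m • z = m • d := fun z d h => by
    have := hmV _ h
    rwa [smul_sub, sub_eq_zero] at this
  have hJ : IsClosed (((X ⊓ V) ⊔ (Y ⊓ V) : AddSubgroup A) : Set A) := by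
    rw [AddSubgroup.add_normal]
    exact ((hVc.inter_left hX).add (hVc.inter_left hY)).isClosed
  refine AddSubgroup.isClosed_of_isClosed_inf hVo
    (AddSubgroup.isClosed_of_finite_cosets hJ ?_ (hF.image fun d => xF d - yF d) ?_)
  · exact sup_le (inf_le_inf_right _ le_sup_left) (inf_le_inf_right _ le_sup_right)
  rintro l ⟨hl, hlV⟩
  obtain ⟨x, hxX, y, hyY, rfl⟩ := AddSubgroup.mem_sup.1 hl
  obtain ⟨x₁, hx₁, x₂, hx₂, rfl, hx₁φ, hx₂φ⟩ := hA.exists_add_primePart φ hxX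
  obtain ⟨y₁, hy₁, y₂, hy₂, rfl, hy₁φ, hy₂φ⟩ := hA.exists_add_primePart φ hyY
  -- Since `V` lies in the `φ`-part, the components at the other primes cancel.
  have h0 : x₂ + y₂ = 0 := eq_zero_of_mem_primePart disjoint_compl_right
    (by
      have := sub_mem (hVφ hlV) (add_mem hx₁φ hy₁φ)
      rwa [show x₁ + x₂ + (y₁ + y₂) - (x₁ + y₁) = x₂ + y₂ by abel] at this)
    (add_mem hx₂φ hy₂φ)
  have hl' : x₁ + x₂ + (y₁ + y₂) = x₁ + y₁ := by
    rw [show x₁ + x₂ + (y₁ + y₂) = x₁ + y₁ + (x₂ + y₂) by abel, h0, add_zero]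
  rw [hl'] at hlV ⊢
  rw [← hDV] at hx₁φ
  obtain ⟨d, hd, v, hv, rfl⟩ := AddSubgroup.mem_sup.1 hx₁φ
  have hyd : y₁ + d ∈ V := by
    have := sub_mem (show d + v + y₁ ∈ V from hlV) hv
    rwa [show d + v + y₁ - v = y₁ + d by abel] at this
  have hdE : d ∈ E := ⟨⟨hd, AddSubgroup.mem_sup.2 ⟨d + v, hx₁, -v, neg_mem hv, by abel⟩⟩,
    AddSubgroup.mem_sup.2 ⟨-y₁, neg_mem hy₁, y₁ + d, hyd, by abel⟩⟩
  obtain ⟨f, hfF, hfd⟩ := hFim.surjOn ⟨d, hdE, rfl⟩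
  obtain ⟨e, he, hed⟩ := QuotientAddGroup.eq.1 hfd
  change m • e = -f + d at hed
  have hfE := hFE hfF
  -- With `d = f + m • e`, subtracting `xF f + m • xF e` from the first summand and adding `yF f + m
  -- • yF e` to the second moves both into `V`; the total changes only by `xF f - yF f`.
  refine ⟨_, ⟨f, hfF, rfl⟩, AddSubgroup.mem_sup.2
    ⟨d + v - xF f - m • xF e, ⟨?_, ?_⟩, y₁ + yF f + m • yF e, ⟨?_, ?_⟩, ?_⟩⟩
  · change _ ∈ X
    exact sub_mem (sub_mem hx₁ (hx f hfE).1) (nsmul_mem (hx e he).1 m)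
  · change _ ∈ V
    rw [hmul _ _ (hx e he).2, hed, show d + v - xF f - (-f + d) = v - (xF f - f) by abel]
    exact sub_mem hv (hx f hfE).2
  · change _ ∈ Y
    exact add_mem (add_mem hy₁ (hy f hfE).1) (nsmul_mem (hy e he).1 m)
  · change _ ∈ V
    rw [hmul _ _ (hy e he).2, hed, show y₁ + yF f + (-f + d) = (y₁ + d) + (yF f - f) by abel]
    exact add_mem hyd (hy f hfE).2
  · rw [hmul _ _ (hy e he).2, hmul _ _ (hx e he).2]
    dsimp only
    abel

end Quasihamiltonian

/-! ### Groups with finite socle. -/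

section FinitePTorsion

/-- Representatives of `G / pG` generate: modulo the group they generate, multiplication by `p` is
onto, hence injective by finiteness, so that quotient of a `p`-group vanishes. Their number is `|G /
pG| = |G[p]|`. -/
theorem exists_finset_closure_eq_top {G : Type*} [AddCommGroup G] [Finite G] {p : ℕ}
    (hG : ∀ x : G, ∃ k : ℕ, p ^ k • x = 0) :
    ∃ E : Finset G, E.card ≤ Nat.card (nsmulAddMonoidHom p : G →+ G).ker ∧
      AddSubgroup.closure (E : Set G) = ⊤ := by
  classical
  set f : G →+ G := nsmulAddMonoidHom p with hf
  have := Fintype.ofFinite (G ⧸ f.range)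
  let E : Finset G := Finset.univ.image fun q : G ⧸ f.range => q.out
  have hcard : Nat.card (G ⧸ f.range) = Nat.card f.ker := by
    have h1 := f.range.card_mul_index
    have h2 := f.ker.card_mul_index
    rw [AddSubgroup.index_ker] at h2
    refine Nat.eq_of_mul_eq_mul_left (Nat.card_pos : 0 < Nat.card f.range) ?_
    rw [mul_comm _ (Nat.card f.ker), h2, ← h1]
    rfl
  refine ⟨E, ?_, ?_⟩
  · rw [← hcard, Nat.card_eq_fintype_card, ← Finset.card_univ]
    exact Finset.card_image_le
  set H := AddSubgroup.closure (E : Set G) with hH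
  have hsurj : Function.Surjective (nsmulAddMonoidHom p : G ⧸ H →+ G ⧸ H) := by
    intro q
    obtain ⟨x, rfl⟩ := QuotientAddGroup.mk_surjective q
    obtain ⟨y, hy⟩ : -(x : G ⧸ f.range).out + x ∈ f.range :=
      QuotientAddGroup.eq.1 (QuotientAddGroup.out_eq' _)
    refine ⟨(y : G ⧸ H), ?_⟩
    change ((p • y : G) : G ⧸ H) = x
    change p • y = _ at hy
    rw [hy]
    refine QuotientAddGroup.eq.2 ?_
    rw [neg_add_rev, neg_neg, add_assoc, add_comm, add_assoc, add_neg_cancel, add_zero]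
    exact AddSubgroup.subset_closure
      (Finset.mem_coe.2 (Finset.mem_image_of_mem _ (Finset.mem_univ _)))
  have hinj := Finite.injective_iff_surjective.2 hsurj
  have hzero : ∀ (k : ℕ) (q : G ⧸ H), p ^ k • q = 0 → q = 0 := by
    intro k
    induction k with
    | zero => intro q hq; simpa using hq
    | succ k ih =>
      intro q hq
      refine hinj ?_
      rw [map_zero]
      exact ih _ (by rwa [nsmulAddMonoidHom_apply, ← mul_smul, ← pow_succ])
  rw [eq_top_iff]
  intro x _
  obtain ⟨k, hk⟩ := hG x
  exact (QuotientAddGroup.eq_zero_iff x).1 (hzero k _ (by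
    rw [← QuotientAddGroup.mk_nsmul, hk, QuotientAddGroup.mk_zero]))

theorem hasFinitePRank_of_finite_torsion {A : Type*} [AddCommGroup A] [TopologicalSpace A]
    [IsTopologicalAddGroup A] (S : AddSubgroup A) [DiscreteTopology S] {p : ℕ} (hp : p.Prime)
    (hS : ∀ x ∈ S, ∃ k : ℕ, p ^ k • x = 0) (hfin : {x | x ∈ S ∧ p • x = 0}.Finite) :
    HasFinitePRank S := by
  classical
  rw [hasFinitePRank_iff_of_discrete]
  refine ⟨{x | x ∈ S ∧ p • x = 0}.ncard, fun F hF => ?_⟩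
  set G := AddSubgroup.closure (F : Set A) with hGdef
  have hGS : G ≤ S := (AddSubgroup.closure_le S).2 hF
  have hfg : AddGroup.FG G := (AddGroup.fg_iff_addSubgroup_fg _).2 ⟨F, rfl⟩
  have hGp : ∀ x : G, ∃ k : ℕ, p ^ k • x = 0 := fun x => by
    obtain ⟨k, hk⟩ := hS x (hGS x.2)
    exact ⟨k, Subtype.ext hk⟩
  have : Finite G := AddCommGroup.finite_of_fg_isAddTorsion G fun x => by
    obtain ⟨k, hk⟩ := hGp x
    exact isOfFinAddOrder_iff_nsmul_eq_zero.2 ⟨p ^ k, pow_pos hp.pos k, hk⟩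
  obtain ⟨E, hE, hEG⟩ := exists_finset_closure_eq_top hGp
  refine ⟨E.image Subtype.val, Finset.card_image_le.trans (hE.trans ?_), ?_⟩
  · rw [← Nat.card_coe_set_eq]
    have := hfin.to_subtype
    refine Nat.card_le_card_of_injective (fun x => ⟨(x : G), hGS (x : G).2, ?_⟩) fun x y hxy => ?_
    · exact congrArg Subtype.val (show p • (x : G) = 0 from x.2)
    · exact Subtype.ext (Subtype.ext (by simpa using hxy))
  · have := congrArg (AddSubgroup.map G.subtype) hEG
    rw [AddMonoidHom.map_closure, ← AddMonoidHom.range_eq_map, AddSubgroup.range_subtype] at this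
    rw [Finset.coe_image]
    exact this

theorem finite_nsmul_mul {Q : Type*} [AddCommGroup Q] {a b : ℕ} (ha : {x : Q | a • x = 0}.Finite)
    (hb : {x : Q | b • x = 0}.Finite) : {x : Q | (a * b) • x = 0}.Finite := by
  refine Set.Finite.of_finite_fibers (fun x : Q => b • x) (ha.subset ?_) ?_
  · rintro _ ⟨x, hx, rfl⟩
    exact (mul_smul a b x).symm.trans hx
  · rintro _ ⟨x, hx, rfl⟩
    refine (hb.image fun y => x + y).subset ?_
    rintro y ⟨_, hy⟩
    refine ⟨y - x, ?_, add_sub_cancel _ _⟩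
    change b • (y - x) = 0
    rw [smul_sub, sub_eq_zero]
    exact hy

theorem finite_nsmul_prod {Q : Type*} [AddCommGroup Q] (s : Finset ℕ)
    (h : ∀ p ∈ s, {x : Q | p • x = 0}.Finite) : {x : Q | (∏ p ∈ s, p) • x = 0}.Finite := by
  classical
  induction s using Finset.induction_on with
  | empty => simp
  | insert p s hps ih =>
    rw [Finset.prod_insert hps]
    exact finite_nsmul_mul (h p (Finset.mem_insert_self _ _))
      (ih fun q hq => h q (Finset.mem_insert_of_mem hq))

theorem finite_nsmul_pow {Q : Type*} [AddCommGroup Q] {a : ℕ} (h : {x : Q | a • x = 0}.Finite)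
    (k : ℕ) : {x : Q | a ^ k • x = 0}.Finite := by
  induction k with
  | zero => simp
  | succ k ih => rw [pow_succ]; exact finite_nsmul_mul ih h

/-- In a group of `R`-power torsion with finite socle, the descending chain of the groups `R ^ k Q`
is stationary. -/
theorem exists_pow_smul_eq_pow_succ_smul {Q : Type*} [AddCommGroup Q] {R : ℕ}
    (hQ : ∀ x : Q, ∃ k : ℕ, R ^ k • x = 0) (hfin : {x : Q | R • x = 0}.Finite) :
    ∃ k : ℕ, ∀ x : Q, ∃ y : Q, R ^ k • x = R ^ (k + 1) • y := by
  let H : ℕ → Set Q := fun k => {x | R • x = 0 ∧ ∃ y, R ^ k • y = x}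
  have hH : ∀ k, (H k).Finite := fun k => hfin.subset fun x hx => hx.1
  -- The finite sets `H k` decrease, so one of minimal cardinality equals all later ones.
  obtain ⟨k, hk⟩ : ∃ k, ∀ j, (H k).ncard ≤ (H j).ncard := by
    refine ⟨Function.argmin (fun k => (H k).ncard), fun j => ?_⟩
    exact Function.argmin_le (fun k => (H k).ncard) j
  have hstab : ∀ j, H k = H (k + j) := fun j => by
    refine (Set.eq_of_subset_of_ncard_le ?_ (hk _) (hH k)).symm
    rintro x ⟨hx, y, rfl⟩
    exact ⟨hx, R ^ j • y, by rw [← mul_smul, ← pow_add]⟩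
  have key : ∀ (i : ℕ) (x : Q), R ^ i • R ^ k • x = 0 → ∃ y, R ^ k • x = R ^ (k + 1) • y := by
    intro i
    induction i with
    | zero =>
      intro x hx
      exact ⟨0, by simpa using hx⟩
    | succ i ih =>
      intro x hx
      -- This socle element equals `R ^ (k + i + 1) • u`, so `R ^ i` kills `R ^ k • (x - R • u)` and
      -- induction applies.
      have hmem : R ^ i • R ^ k • x ∈ H (k + (i + 1)) := by
        rw [← hstab]
        refine ⟨by rwa [← mul_smul, ← pow_succ'], R ^ i • x, smul_comm _ _ _⟩
      obtain ⟨_, u, hu⟩ := hmem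
      obtain ⟨y, hy⟩ := ih (x - R • u) (by
        rw [smul_sub, smul_sub, ← hu, ← mul_smul, ← mul_smul, ← pow_add, ← pow_succ, sub_eq_zero]
        congr 2
        ring)
      refine ⟨y + u, ?_⟩
      rw [smul_add, ← hy, smul_sub, ← mul_smul, ← pow_succ, sub_add_cancel]
  refine ⟨k, fun x => ?_⟩
  obtain ⟨i, hi⟩ := hQ x
  exact key i x (by rw [smul_comm, hi, smul_zero])

theorem Nat.exists_dvd_pow_of_primes {R a : ℕ} (ha : a ≠ 0) (h : ∀ q, q.Prime → q ∣ a → q ∣ R) :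
    ∃ j, a ∣ R ^ j := by
  induction a using Nat.recOnMul with
  | zero => exact absurd rfl ha
  | one => exact ⟨0, one_dvd _⟩
  | prime p hp => exact ⟨1, by simpa using h p hp dvd_rfl⟩
  | mul x y hx hy =>
    obtain ⟨i, hi⟩ := hx (left_ne_zero_of_mul ha) fun q hq hqx => h q hq (hqx.mul_right y)
    obtain ⟨j, hj⟩ := hy (right_ne_zero_of_mul ha) fun q hq hqy => h q hq (hqy.mul_left x)
    exact ⟨i + j, pow_add R i j ▸ mul_dvd_mul hi hj⟩

end FinitePTorsion

/-! ### Splitting off a discrete divisible subgroup. -/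

section Splitting

variable {A : Type*} [AddCommGroup A] [TopologicalSpace A] [IsTopologicalAddGroup A]

theorem discreteTopology_of_finite_inf [T2Space A] {T K : AddSubgroup A} (hK : IsOpen (K : Set A))
    (h : ((T ⊓ K : AddSubgroup A) : Set A).Finite) : DiscreteTopology T := by
  refine discreteTopology_of_isOpen_singleton_zero ?_
  have h1 : IsOpen ((Subtype.val : T → A) ⁻¹' ((K : Set A) \ ((T ⊓ K : AddSubgroup A) \ {0}))) :=
    (hK.sdiff (h.subset Set.sdiff_subset).isClosed).preimage continuous_subtype_val
  convert h1 using 1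
  ext x
  constructor
  · rintro rfl
    simp
  · rintro ⟨hxK, hx⟩
    by_contra hne
    exact hx ⟨⟨x.2, hxK⟩, fun h => hne (Subtype.ext h)⟩

theorem NonarchimedeanAddGroup.exists_isOpen_inf_eq_bot {A : Type*} [AddCommGroup A]
    [TopologicalSpace A] [NonarchimedeanAddGroup A] [T2Space A] {F : Set A} (hF : F.Finite) :
    ∃ U : AddSubgroup A, IsOpen (U : Set A) ∧ ∀ x ∈ U, x ∈ F → x = 0 := by
  have hn : (F \ {0})ᶜ ∈ 𝓝 (0 : A) :=
    (hF.subset Set.sdiff_subset).isClosed.isOpen_compl.mem_nhds (by simp)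
  obtain ⟨V, hV⟩ := NonarchimedeanAddGroup.is_nonarchimedean _ hn
  refine ⟨V.toAddSubgroup, V.isOpen, fun x hx hxF => ?_⟩
  by_contra hne
  exact hV hx ⟨hxF, hne⟩

/-- A discrete divisible subgroup of an open subgroup `S` which together with a compact open
subgroup generates `S` has a compact open complement. -/
theorem exists_compact_open_complement {D S K₁ K₂ : AddSubgroup A} [DiscreteTopology D]
    (hdiv : ∀ n : ℕ, n ≠ 0 → Function.Surjective (fun d : D => n • d)) (hDS : D ≤ S)
    (hK₁ : IsCompact (K₁ : Set A)) (hS : ∀ x ∈ S, ∃ k ∈ K₁, x - k ∈ D)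
    (hK₂c : IsCompact (K₂ : Set A)) (hK₂o : IsOpen (K₂ : Set A)) (hK₂S : K₂ ≤ S)
    (hDK₂ : D ⊓ K₂ = ⊥) :
    ∃ V : AddSubgroup A, IsTopologicalDirectSum S D V ∧ IsCompact (V : Set A) ∧
      IsOpen (V : Set A) := by
  let _ : DivisibleBy D ℤ :=
    divisibleByOfSMulRightSurj D ℤ fun {n} hn d => by
      obtain ⟨y, hy⟩ := hdiv n.natAbs (Int.natAbs_ne_zero.2 hn) d
      rcases Int.natAbs_eq n with h | h
      · exact ⟨y, by rw [← hy]; dsimp only; rw [h]; simp [← natCast_zsmul]⟩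
      · refine ⟨-y, ?_⟩
        rw [← hy]
        dsimp only
        rw [← natCast_zsmul, smul_neg, ← neg_smul]
        congr 1
        omega
  let f : D × K₂ →+ A := D.subtype.coprod K₂.subtype
  have hf : Function.Injective f := by
    rw [injective_iff_map_eq_zero]
    rintro ⟨d, k⟩ h
    have h' : (d : A) = -k := eq_neg_of_add_eq_zero_left h
    have hd : (d : A) ∈ D ⊓ K₂ := ⟨d.2, show (d : A) ∈ K₂ from h' ▸ neg_mem k.2⟩
    rw [hDK₂, AddSubgroup.mem_bot] at hd
    rw [hd, zero_eq_neg] at h'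
    exact Prod.ext (Subtype.ext hd) (Subtype.ext h')
  -- The divisible group `D` is injective, so the projection `D × K₂ → D` extends to `A`. The
  -- extension `h` is continuous because it kills the open `K₂`, and `S ⊓ h.ker` is the complement.
  obtain ⟨h, hh⟩ := (Module.Baer.of_divisible D).extension_property_addMonoidHom f hf
    (AddMonoidHom.fst D K₂)
  have hD : ∀ d : D, h d = d := fun d => by
    have := DFunLike.congr_fun hh (d, 0)
    simpa [f] using this
  have hK : ∀ k ∈ K₂, h k = 0 := fun k hk => by
    have := DFunLike.congr_fun hh (0, ⟨k, hk⟩)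
    simpa [f] using this
  let V : AddSubgroup A := S ⊓ h.ker
  have hKV : K₂ ≤ V := le_inf hK₂S hK
  have hVo : IsOpen (V : Set A) := AddSubgroup.isOpen_mono hKV hK₂o
  have hcont : Continuous h := by
    refine continuous_of_continuousAt_zero h ?_
    rw [ContinuousAt, map_zero]
    refine tendsto_nhds_of_eventually_eq ?_
    filter_upwards [hK₂o.mem_nhds (zero_mem K₂)] with x hx using hK x hx
  refine ⟨V, ⟨le_antisymm (sup_le hDS inf_le_left) fun x hx => ?_, ?_⟩, ?_, hVo⟩
  · refine AddSubgroup.mem_sup.2 ⟨h x, (h x).2, x - h x, ⟨show _ ∈ S from sub_mem hx (hDS (h x).2), ?_⟩,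
      add_sub_cancel _ _⟩
    change h (x - h x) = 0
    rw [map_sub, hD, sub_self]
  · have hg : Continuous fun x : A => (h x, x - h x) := by fun_prop
    refine IsEmbedding.of_comp (by fun_prop) hg ?_
    have : (fun x : A => (h x, x - h x)) ∘ (fun x : D × V => (x.1 : A) + (x.2 : A)) =
        Prod.map id Subtype.val := by
      funext ⟨d, v⟩
      have hv : h v = 0 := v.2.2
      simp [hD, hv]
    rw [this]
    exact IsEmbedding.id.prodMap IsEmbedding.subtypeVal
  · obtain ⟨F, -, hF, hFK⟩ := hK₁.exists_finite_cosets hK₂o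
    -- If `h x = 0` and `x - k ∈ D`, then `x = k - h k`; replacing `k` by `y` with `k - y ∈ K₂`
    -- leaves `h k` unchanged.
    refine AddSubgroup.isCompact_of_finite_cosets hK₂c hKV (hF.image fun y => y - (h y : A)) ?_
    rintro x ⟨hxS, hx⟩
    change h x = 0 at hx
    obtain ⟨k, hk, hxk⟩ := hS x hxS
    obtain ⟨y, hy, hky⟩ := hFK k hk
    refine ⟨_, ⟨y, hy, rfl⟩, ?_⟩
    have h1 := hD ⟨x - k, hxk⟩
    have h2 := hK _ hky
    dsimp only at h1
    rw [map_sub, hx, zero_sub] at h1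
    rw [map_sub, sub_eq_zero] at h2
    have h3 : (h y : A) = -(x - k) := by
      rw [← h2, ← neg_neg (h k), h1]
      rfl
    dsimp only
    rw [h3, show x - (y - -(x - k)) = k - y by abel]
    exact hky

end Splitting

/-! ### Decomposition of the `φ`-part and choice of `φ`. -/

section Decomposition

variable {A : Type*} [AddCommGroup A] [TopologicalSpace A] [IsTopologicalAddGroup A]
  [LocallyCompactSpace A] [T2Space A]

theorem exists_pow_smul_eq_zero_of_mem_primePart {A : Type*} [AddCommGroup A] {φ : Set ℕ} {R : ℕ}
    (hR : ∀ q ∈ φ, q ∣ R) {x : A} (hx : x ∈ primePart A φ) : ∃ k : ℕ, R ^ k • x = 0 := by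
  obtain ⟨m, hm, hmφ, hmx⟩ := hx
  obtain ⟨j, c, hc⟩ := Nat.exists_dvd_pow_of_primes hm fun q hq hqm => hR q (hmφ q hq hqm)
  exact ⟨j, by rw [hc, mul_comm, mul_smul, hmx, smul_zero]⟩

theorem exists_uniform_pow_smul_eq_zero {A : Type*} [AddCommGroup A] {φ : Set ℕ} {R n : ℕ}
    (hR : ∀ q ∈ φ, q ∣ R) (hn : n ≠ 0) :
    ∃ k : ℕ, ∀ x ∈ primePart A φ, n • x = 0 → R ^ k • x = 0 := by
  obtain ⟨a, b, rfl, ha, hb⟩ := Nat.exists_mul_eq_of_primes φ hn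
  obtain ⟨j, c, hc⟩ :=
    Nat.exists_dvd_pow_of_primes (left_ne_zero_of_mul hn) fun q hq hqa => hR q (ha q hq hqa)
  refine ⟨j, fun x hx hnx => ?_⟩
  obtain ⟨m, hm, hmφ, hmx⟩ := hx
  have : a • x = 0 := eq_zero_of_coprime_nsmul (Nat.coprime_of_primes hmφ hb)
    (by rw [smul_comm, hmx, smul_zero]) (by rwa [← mul_smul, mul_comm])
  rw [hc, mul_comm, mul_smul, this, smul_zero]

/-- Multiplication by a nonzero number is onto on a subgroup of `primePart A φ` on which
multiplication by `R` is onto, where `R` is divisible by the primes in `φ`. -/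
theorem nsmul_surjective_of_primePart {A : Type*} [AddCommGroup A] {φ : Set ℕ} {R : ℕ}
    (hR : ∀ q ∈ φ, q ∣ R) (hRφ : ∀ q, q.Prime → q ∣ R → q ∈ φ) {D : AddSubgroup A}
    (hD : D ≤ primePart A φ) (hdiv : ∀ d ∈ D, ∃ d' ∈ D, R • d' = d) {n : ℕ} (hn : n ≠ 0) :
    Function.Surjective (fun d : D => n • d) := by
  -- The factor `a` divides a power of `R`, and `b` is prime to `R`, hence invertible on each
  -- element of `D`.
  obtain ⟨a, b, rfl, ha, hb⟩ := Nat.exists_mul_eq_of_primes φ hn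
  obtain ⟨j, c, hc⟩ :=
    Nat.exists_dvd_pow_of_primes (left_ne_zero_of_mul hn) fun q hq hqa => hR q (ha q hq hqa)
  have hpow : ∀ (i : ℕ), ∀ d ∈ D, ∃ d' ∈ D, R ^ i • d' = d := by
    intro i
    induction i with
    | zero => exact fun d hd => ⟨d, hd, by simp⟩
    | succ i ih =>
      intro d hd
      obtain ⟨d₁, hd₁, rfl⟩ := ih d hd
      obtain ⟨d₂, hd₂, rfl⟩ := hdiv d₁ hd₁
      exact ⟨d₂, hd₂, by rw [pow_succ, mul_smul]⟩
  rintro ⟨d, hd⟩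
  obtain ⟨i, hi⟩ := exists_pow_smul_eq_zero_of_mem_primePart hR (hD hd)
  have hcop : (b : ℕ).Coprime (R ^ i) := (Nat.coprime_of_primes (σ := φ)
    (fun q hq hqR => hRφ q hq (hq.dvd_of_dvd_pow hqR)) hb).symm
  obtain ⟨u, w, huw⟩ := Nat.isCoprime_iff_coprime.2 hcop
  have hbd : b • u • d = d := by
    have h1 : (u * b + w * (R ^ i : ℕ)) • d = d := by rw [huw, one_smul]
    rw [add_smul, mul_smul, mul_smul, natCast_zsmul, natCast_zsmul, hi, smul_zero, add_zero] at h1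
    rwa [smul_comm]
  obtain ⟨d', hd', hdd⟩ := hpow j (u • d) (zsmul_mem hd u)
  refine ⟨⟨c • d', nsmul_mem hd' c⟩, Subtype.ext ?_⟩
  change (a * b) • c • d' = d
  rw [mul_comm, mul_smul, ← mul_smul a, ← hc, hdd, hbd]

theorem IsAddTorsion.exists_divisible_compact_decomposition (hA : IsAddTorsion A) {φ : Set ℕ}
    (hφp : ∀ p ∈ φ, p.Prime) (hφ : φ.Finite) {K : AddSubgroup A} (hKc : IsCompact (K : Set A))
    (hKo : IsOpen (K : Set A)) (hKφ : K ≤ primePart A φ)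
    (hfin : ∀ p ∈ φ, ((fun x : A => (x : A ⧸ K)) '' {x | p • x ∈ K}).Finite) :
    ∃ D V : AddSubgroup A, IsTopologicalDirectSum (primePart A φ) D V ∧ DiscreteTopology D ∧
      (∀ n : ℕ, n ≠ 0 → Function.Surjective (fun d : D => n • d)) ∧
      (∀ p ∈ φ, HasFinitePRank (D ⊓ primaryComponent A p : AddSubgroup A)) ∧
      IsCompact (V : Set A) ∧ IsOpen (V : Set A) := by
  classical
  set S := primePart A φ with hS
  set R : ℕ := ∏ p ∈ hφ.toFinset, p with hRdef
  have hR : ∀ q ∈ φ, q ∣ R := fun q hq => Finset.dvd_prod_of_mem _ (hφ.mem_toFinset.2 hq)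
  have hRφ : ∀ q, q.Prime → q ∣ R → q ∈ φ := fun q hq hqR => by
    obtain ⟨p, hp, hqp⟩ := (hq.prime.dvd_finsetProd_iff _).1 hqR
    have hp' := hφ.mem_toFinset.1 hp
    rwa [(Nat.prime_dvd_prime_iff_eq hq (hφp p hp')).1 hqp]
  have hQ : ∀ j, {x : A ⧸ K | R ^ j • x = 0}.Finite := finite_nsmul_pow
    (finite_nsmul_prod _ fun p hp => (hfin p (hφ.mem_toFinset.1 hp)).subset fun q hq => by
      obtain ⟨x, rfl⟩ := QuotientAddGroup.mk_surjective q
      exact ⟨x, (QuotientAddGroup.eq_zero_iff _).1 hq, rfl⟩)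
  have hpow_mem : ∀ (j : ℕ) (x : A), R ^ j • x ∈ K → (x : A ⧸ K) ∈ {x : A ⧸ K | R ^ j • x = 0} :=
    fun j x hx => (QuotientAddGroup.eq_zero_iff _).2 hx
  have hpow_S : ∀ (j : ℕ) (x : A), R ^ j • x ∈ S → x ∈ S := by
    rintro j x ⟨m, hm, hmφ, hmx⟩
    refine ⟨m * R ^ j, mul_ne_zero hm (pow_ne_zero _ (Finset.prod_ne_zero_iff.2 fun p hp =>
      (hφp p (hφ.mem_toFinset.1 hp)).ne_zero)), fun q hq hqm => ?_, by rwa [mul_smul]⟩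
    exact ((Nat.Prime.dvd_mul hq).1 hqm).elim (hmφ q hq)
      fun h => hRφ q hq (hq.dvd_of_dvd_pow h)
  obtain ⟨n, hn, hnK⟩ := hA.exists_nsmul_eq_zero_of_isCompact hKc
  obtain ⟨e₁, he₁⟩ := exists_uniform_pow_smul_eq_zero (A := A) hR hn
  obtain ⟨k, hk⟩ : ∃ k : ℕ, ∀ x ∈ S, ∃ y ∈ S, R ^ k • x - R ^ (k + 1) • y ∈ K := by
    obtain ⟨k, hk⟩ := exists_pow_smul_eq_pow_succ_smul (Q := S.map (QuotientAddGroup.mk' K)) (R := R)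
      (by
        rintro ⟨_, x, hx, rfl⟩
        obtain ⟨j, hj⟩ := exists_pow_smul_eq_zero_of_mem_primePart hR hx
        refine ⟨j, Subtype.ext ?_⟩
        change R ^ j • QuotientAddGroup.mk' K x = 0
        rw [← map_nsmul, hj, map_zero])
      (by
        have := (hQ 1).preimage (Subtype.val_injective (p := (· ∈ S.map (QuotientAddGroup.mk' K)))).injOn
        refine this.subset fun x hx => ?_
        simpa using congrArg Subtype.val hx)
    refine ⟨k, fun x hx => ?_⟩
    obtain ⟨⟨_, y, hy, rfl⟩, hxy⟩ := hk ⟨_, x, hx, rfl⟩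
    refine ⟨y, hy, (QuotientAddGroup.eq_zero_iff _).1 ?_⟩
    rw [QuotientAddGroup.mk_sub, sub_eq_zero]
    exact congrArg Subtype.val hxy
  have hkj : ∀ (j : ℕ), ∀ x ∈ S, ∃ y ∈ S, R ^ k • x - R ^ (k + j) • y ∈ K := by
    intro j
    induction j with
    | zero => exact fun x hx => ⟨x, hx, by simp⟩
    | succ j ih =>
      intro x hx
      obtain ⟨y, hy, hxy⟩ := ih x hx
      obtain ⟨z, hz, hyz⟩ := hk y hy
      refine ⟨z, hz, ?_⟩
      have := add_mem hxy (nsmul_mem hyz (R ^ j))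
      rwa [smul_sub, ← mul_smul, ← mul_smul, ← pow_add, ← pow_add, add_comm j k, sub_add_sub_cancel,
        show j + (k + 1) = k + (j + 1) by ring] at this
  -- `R ^ k` sends `K₁` into `K` and `R ^ e₁` kills `K`; the extra factor `R` gives the divisibility
  -- in `hdivR`.
  set e := k + e₁ + 1 with he
  set K₁ : AddSubgroup A := K.comap (nsmulAddMonoidHom (R ^ k)) with hK₁
  have hK₁S : K₁ ≤ S := fun x hx => hpow_S k x (hKφ hx)
  have heK : ∀ x ∈ K, ∀ j, R ^ (e₁ + j) • x = 0 := fun x hx j => by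
    rw [add_comm, pow_add, mul_smul, he₁ x (hKφ hx) (hnK x hx), smul_zero]
  have heK' : ∀ x ∈ K, R ^ e • x = 0 := fun x hx => by
    rw [he, show k + e₁ + 1 = e₁ + (k + 1) by ring]; exact heK x hx _
  have heK₁ : ∀ x ∈ K₁, R ^ e • x = 0 := fun x hx => by
    rw [he, show k + e₁ + 1 = e₁ + 1 + k by ring, pow_add, mul_smul]; exact heK _ hx _
  have hKK₁ : K ≤ K₁ := fun x hx => nsmul_mem hx _
  have hK₁c : IsCompact (K₁ : Set A) := by
    refine AddSubgroup.isCompact_of_finite_cosets hKc hKK₁ ((hQ k).image Quotient.out) fun x hx =>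
      ⟨_, ⟨(x : A ⧸ K), hpow_mem k x hx, rfl⟩, ?_⟩
    have : -(x : A ⧸ K).out + x ∈ K := QuotientAddGroup.eq.1 (QuotientAddGroup.out_eq' _)
    rwa [neg_add_eq_sub] at this
  set D : AddSubgroup A := S.map (nsmulAddMonoidHom (R ^ e)) with hD
  have hDS : D ≤ S := by
    rintro _ ⟨x, hx, rfl⟩
    exact nsmul_mem hx _
  have hsum : ∀ x ∈ S, ∃ l ∈ K₁, x - l ∈ D := by
    intro x hx
    obtain ⟨y, hy, hxy⟩ := hkj e x hx
    refine ⟨x - R ^ e • y, ?_, y, hy, ?_⟩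
    · change R ^ k • (x - R ^ e • y) ∈ K
      rwa [smul_sub, ← mul_smul, ← pow_add]
    · rw [sub_sub_cancel]
      rfl
  -- Write `x = l + R ^ e • y` with `l ∈ K₁`. As `R ^ e` kills `l`, `R ^ e • x = R ^ e • R ^ e • y`.
  have hdivR : ∀ d ∈ D, ∃ d' ∈ D, R • d' = d := by
    rintro _ ⟨x, hx, rfl⟩
    obtain ⟨l, hl, y, hy, hxy⟩ := hsum x hx
    refine ⟨R ^ (k + e₁) • R ^ e • y, nsmul_mem (show R ^ e • y ∈ D from ⟨y, hy, rfl⟩) _, ?_⟩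
    change R ^ e • y = x - l at hxy
    rw [hxy, ← mul_smul, ← pow_succ']
    change R ^ e • (x - l) = R ^ e • x
    rw [smul_sub, heK₁ l hl, sub_zero]
  -- An element `R ^ e • x` depends only on `x` modulo `K`, and if `R ^ i` kills it, then the class
  -- of `x` lies in the finite group `(A / K)[R ^ (i + e)]`.
  have hDfin : ∀ i, {d | d ∈ D ∧ R ^ i • d = 0}.Finite := by
    intro i
    have h1 : ((fun x : A => (x : A ⧸ K)) '' {x | R ^ (i + e) • x = 0}).Finite := by
      refine (hQ (i + e)).subset ?_
      rintro _ ⟨x, hx, rfl⟩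
      exact hpow_mem _ _ (by rw [show R ^ (i + e) • x = 0 from hx]; exact zero_mem K)
    refine (h1.image_of_factor (g := fun x => R ^ e • x) fun x _ y _ hxy => ?_).subset ?_
    · have h2 := heK' _ (QuotientAddGroup.eq.1 hxy)
      rw [smul_add, smul_neg, neg_add_eq_zero] at h2
      exact h2
    · rintro _ ⟨⟨x, hx, rfl⟩, hd⟩
      refine ⟨x, ?_, rfl⟩
      change R ^ (i + e) • x = 0
      rw [pow_add, mul_smul]
      exact hd
  have hDK₁ : ((D ⊓ K₁ : AddSubgroup A) : Set A).Finite :=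
    (hDfin e).subset fun d hd => ⟨hd.1, heK₁ d hd.2⟩
  have hdisc : DiscreteTopology D :=
    discreteTopology_of_finite_inf (AddSubgroup.isOpen_mono hKK₁ hKo) hDK₁
  have hna := hA.nonarchimedeanAddGroup
  obtain ⟨U, hUo, hU⟩ := NonarchimedeanAddGroup.exists_isOpen_inf_eq_bot hDK₁
  have hdiv : ∀ n : ℕ, n ≠ 0 → Function.Surjective (fun d : D => n • d) := fun n hn =>
    nsmul_surjective_of_primePart hR hRφ hDS hdivR hn
  obtain ⟨V, hV, hVc, hVo⟩ := exists_compact_open_complement hdiv hDS hK₁c hsum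
    (hKc.inter_right (AddSubgroup.isClosed_of_isOpen U hUo)) (hKo.inter hUo)
    (inf_le_left.trans hKφ : K ⊓ U ≤ S)
    (eq_bot_iff.2 fun x hx => hU x hx.2.2 ⟨hx.1, hKK₁ hx.2.1⟩)
  refine ⟨D, V, hV, hdisc, hdiv, fun p hp => ?_, hVc, hVo⟩
  have : DiscreteTopology (D ⊓ primaryComponent A p : AddSubgroup A) :=
    DiscreteTopology.of_subset (s := (D : Set A)) hdisc Set.inter_subset_left
  refine hasFinitePRank_of_finite_torsion _ (hφp p hp) (fun x hx => ?_) ?_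
  · have h := hx.2
    rw [hA.primaryComponent_eq (hφp p hp)] at h
    exact (mem_primePart_singleton (hφp p hp)).1 h
  · refine (hDfin 1).subset fun d hd => ⟨hd.1.1, ?_⟩
    obtain ⟨c, hc⟩ := hR p hp
    rw [pow_one, hc, mul_comm, mul_smul, hd.2, smul_zero]

theorem finite_inf_primePart_singleton {A : Type*} [AddCommGroup A] {K : AddSubgroup A} {p n : ℕ}
    (hn : n ≠ 0) (hnK : ∀ x ∈ K, n • x = 0) (hK : {x | x ∈ K ∧ p • x = 0}.Finite) :
    ((K ⊓ primePart A {p} : AddSubgroup A) : Set A).Finite := by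
  have : ∀ k : ℕ, {x | x ∈ K ∧ p ^ k • x = 0}.Finite := by
    intro k
    induction k with
    | zero => exact (Set.finite_singleton (0 : A)).subset fun x hx => by simpa using hx.2
    | succ k ih =>
      refine Set.Finite.of_finite_fibers (fun x : A => p • x) (ih.subset ?_) ?_
      · rintro _ ⟨x, ⟨hx, hpx⟩, rfl⟩
        exact ⟨nsmul_mem hx p, by rwa [← mul_smul, ← pow_succ]⟩
      · rintro _ ⟨x, hx, rfl⟩
        refine (hK.image fun y => x + y).subset ?_
        rintro y ⟨hy, hxy⟩
        refine ⟨y - x, ⟨sub_mem hy.1 hx.1, ?_⟩, add_sub_cancel _ _⟩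
        rw [smul_sub, sub_eq_zero]
        exact hxy
  obtain ⟨k, hk⟩ := exists_uniform_pow_smul_eq_zero (A := A) (φ := {p}) (R := p)
    (fun q hq => by rw [Set.mem_singleton_iff.1 hq]) hn
  exact (this k).subset fun x hx => ⟨hx.1, hk x hx.2 (hnK x hx.1)⟩

/-- Some compact open subgroup lies in the sum of finitely many primary components, and its
intersection with each of them is infinite. -/
theorem IsAddTorsion.exists_compact_open_primary_infinite (hA : IsAddTorsion A) :
    ∃ (φ : Set ℕ) (K : AddSubgroup A), φ.Finite ∧ φ ⊆ primeSupport A ∧ IsCompact (K : Set A) ∧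
      IsOpen (K : Set A) ∧ K ≤ primePart A φ ∧ K ⊓ primePart A φᶜ = ⊥ ∧
      ∀ p ∈ φ, {x | x ∈ K ∧ p • x = 0}.Infinite := by
  classical
  obtain ⟨K₀, hK₀c, hK₀o, n, hn, hnK₀⟩ := hA.exists_isCompact_isOpen_nsmul_eq_zero
  -- These primes divide `n`, so they are finitely many. For the other primes dividing `n` the
  -- primary parts of `K₀` are finite, and a small open `U` avoids their nonzero elements.
  let φ : Set ℕ := {p | p.Prime ∧ ((K₀ ⊓ primePart A {p} : AddSubgroup A) : Set A).Infinite}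
  have hndvd : ∀ p, p.Prime → ¬ p ∣ n → K₀ ⊓ primePart A {p} = ⊥ := by
    intro p hp hpn
    rw [eq_bot_iff]
    rintro x ⟨hxK, hx⟩
    obtain ⟨k, hk⟩ := (mem_primePart_singleton hp).1 hx
    exact eq_zero_of_coprime_nsmul (((Nat.Prime.coprime_iff_not_dvd hp).2 hpn).pow_left k) hk
      (hnK₀ x hxK)
  have hφn : φ ⊆ n.primeFactors := fun p hp => by
    rw [Finset.mem_coe, Nat.mem_primeFactors]
    refine ⟨hp.1, ?_, hn⟩
    by_contra h
    have := hp.2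
    rw [hndvd p hp.1 h] at this
    exact this (by simp)
  let F : Set A := ⋃ p ∈ (n.primeFactors : Set ℕ) \ φ, ((K₀ ⊓ primePart A {p} : AddSubgroup A) : Set A)
  have hF : F.Finite := by
    refine Set.Finite.biUnion ((Finset.finite_toSet _).subset Set.sdiff_subset) fun p hp => ?_
    by_contra h
    exact hp.2 ⟨(Nat.mem_primeFactors.1 hp.1).1, h⟩
  have hna := hA.nonarchimedeanAddGroup
  obtain ⟨U, hUo, hU⟩ := NonarchimedeanAddGroup.exists_isOpen_inf_eq_bot hF
  have hbot : ∀ p, p.Prime → p ∉ φ → K₀ ⊓ U ⊓ primePart A {p} = ⊥ := by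
    intro p hp hpφ
    by_cases hpn : p ∣ n
    · rw [eq_bot_iff]
      rintro x ⟨⟨hxK, hxU⟩, hx⟩
      exact hU x hxU (Set.mem_biUnion (x := p) ⟨Nat.mem_primeFactors.2 ⟨hp, hpn, hn⟩, hpφ⟩
        ⟨hxK, hx⟩)
    · rw [eq_bot_iff, ← hndvd p hp hpn]
      exact inf_le_inf_right _ inf_le_left
  have hcompl : K₀ ⊓ U ⊓ primePart A φᶜ = ⊥ := by
    rw [primePart_inf_eq_iSup, eq_bot_iff]
    refine iSup₂_le fun p hp => ?_
    by_cases hpp : p.Prime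
    · exact (hbot p hpp hp).le
    · rintro x ⟨-, m, hm, hmp, hmx⟩
      have : m = 1 := by
        by_contra h1
        obtain ⟨q, hq, hqm⟩ := Nat.exists_prime_and_dvd h1
        exact hpp (Set.mem_singleton_iff.1 (hmp q hq hqm) ▸ hq)
      simpa [this] using hmx
  refine ⟨φ, K₀ ⊓ U, (Finset.finite_toSet _).subset hφn, fun p hp => ⟨hp.1, fun h => ?_⟩,
    hK₀c.inter_right (AddSubgroup.isClosed_of_isOpen U hUo), hK₀o.inter hUo, fun x hx => ?_, hcompl,
    fun p hp hfin => ?_⟩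
  · have := hp.2
    rw [← hA.primaryComponent_eq hp.1, h, inf_bot_eq] at this
    exact this (by simp)
  · obtain ⟨y, hy, z, hz, rfl, hyφ, hzφ⟩ := hA.exists_add_primePart φ hx
    have hz0 : z ∈ K₀ ⊓ U ⊓ primePart A φᶜ := ⟨hz, hzφ⟩
    rw [hcompl, AddSubgroup.mem_bot] at hz0
    rwa [hz0, add_zero]
  -- Finite `p`-torsion and bounded exponent make the `p`-part of `K₀ ⊓ U` finite; as `K₀ ⊓ U` has
  -- finite index in `K₀`, the `p`-part of `K₀` would be finite too.
  · have h1 := finite_inf_primePart_singleton (K := K₀ ⊓ U) hn (fun x hx => hnK₀ x hx.1) hfin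
    refine hp.2 (AddSubgroup.finite_of_finite_image_mk (U := U)
      ((hK₀c.finite_image_mk hUo).subset (Set.image_mono Set.inter_subset_left)) ?_)
    rwa [inf_right_comm] at h1

end Decomposition

/-! ### The equivalence. -/

theorem theorem3 (A : Type*) [AddCommGroup A] [TopologicalSpace A] [IsTopologicalAddGroup A]
    [LocallyCompactSpace A] [T2Space A] (hA : IsAddTorsion A) :
    List.TFAE
      [IsTopologicallyModular A,
       ∃ δ φ : Set ℕ, δ ∪ φ = primeSupport A ∧ Disjoint δ φ ∧
         (φ.Finite ∧
           ∃ D V : AddSubgroup A,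
             IsTopologicalDirectSum (primaryComponentOfSet A φ) D V ∧
             DiscreteTopology D ∧
             (∀ n : ℕ, n ≠ 0 → Function.Surjective (fun d : D => n • d)) ∧
             (∀ p ∈ φ, HasFinitePRank (D ⊓ primaryComponent A p : AddSubgroup A)) ∧
             IsCompact (V : Set A) ∧ IsOpen (V : Set A)) ∧
         DiscreteTopology (primaryComponentOfSet A δ),
       IsStronglyTopologicallyQuasihamiltonian A] := by
  tfae_have 1 → 2 := by
    intro hmod
    obtain ⟨φ, K, hφ, hφA, hKc, hKo, hKφ, hKcompl, hinf⟩ := hA.exists_compact_open_primary_infinite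
    have hφp : ∀ p ∈ φ, p.Prime := fun p hp => (hφA hp).1
    refine ⟨primeSupport A \ φ, φ, Set.sdiff_union_of_subset hφA, disjoint_sdiff_self_left,
      ⟨hφ, ?_⟩, ?_⟩
    · rw [hA.primaryComponentOfSet_eq hφp]
      exact hA.exists_divisible_compact_decomposition hφp hφ hKc hKo hKφ fun p hp =>
        hmod.finite_torsion_quotient hA hKc hKo (hφp p hp) (hinf p hp)
    · rw [hA.primaryComponentOfSet_eq fun p hp => hp.1.1]
      refine discreteTopology_of_finite_inf hKo ?_
      have hbot : primePart A (primeSupport A \ φ) ⊓ K = ⊥ := by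
        rw [eq_bot_iff, ← hKcompl, inf_comm]
        exact inf_le_inf_left _ (primePart_mono fun p hp => hp.2)
      rw [hbot]
      simp
  tfae_have 2 → 3 := by
    rintro ⟨δ, φ, hδφ, -, ⟨hφ, D, V, ⟨hDV, -⟩, hD, -, hrank, hVc, hVo⟩, -⟩
    exact hA.isStronglyTopologicallyQuasihamiltonian
      (fun p hp => ((hδφ ▸ Or.inr hp : p ∈ primeSupport A)).1) hφ hDV hrank hVc hVo
  tfae_have 3 → 1 := fun h => h.isTopologicallyModular
  tfae_finish
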